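/- For a topological space $X$ let $S(X)$ be the vector lattice of equivalence classes of real-valued functions that are defined and continuous on an open dense subset of $X$, two functions being equivalent if they agree on the intersection of their domains, with pointwise operations and order (on open dense sets). Let $E$ be an order complete vector lattice. A representation of $E$ is given by a family $(B_\alpha)_{\alpha\in I}$ of pairwise disjoint bands of $E$ such that only $0$ is disjoint from all of them, where each $B_\alpha$ has a weak unit $u_\alpha>0$, together with compact Hausdorff spaces $X_\alpha$ and injective linear lattice homomorphisms $T_\alpha\colon B_\alpha\to S(X_\alpha)$ such that $T_\alpha(u_\alpha)=\mathbf 1_{X_\alpha}$ and such that $T_\alpha$ maps the ideal of $B_\alpha$ generated by $u_\alpha$ into $C(X_\alpha)$, with image dense in $C(X_\alpha)$ for the sup norm. With $X=\bigsqcup_\alpha X_\alpha$, so that $S(X)=\prod_\alpha S(X_\alpha)$, and with $P_\alpha\colon E\to B_\alpha$ the band projections, the representation is the map $$T\colon E\to S(X),\qquad T(x)=\bigl(T_\alpha(P_\alpha x)\bigr)_\alpha .$$ Then $E$ has such a representation, and for every such representation $T$ is an injective linear lattice homomorphism and $T(E)$ is an ideal (a solid linear subspace) of $S(X)$. Thus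 $E$ can be considered as an ideal of $S(X)$. -/

import Mathlib

open Filter Topology

universe u v w

noncomputable section

/-! ### The vector lattice `S(X)` -/

/-- The filter of subsets of `X` that contain an open dense set. -/
def openDenseFilter (X : Type*) [TopologicalSpace X] : Filter X where
  sets := {s | ∃ U : Set X, IsOpen U ∧ Dense U ∧ U ⊆ s}
  univ_sets := ⟨Set.univ, isOpen_univ, dense_univ, subset_rfl⟩
  sets_of_superset := fun ⟨U, ho, hd, hU⟩ hst => ⟨U, ho, hd, hU.trans hst⟩
  inter_sets := fun ⟨U, ho, hd, hU⟩ ⟨V, ho', hd', hV⟩ =>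
    ⟨U ∩ V, ho.inter ho', hd.inter_of_isOpen_left hd' ho, Set.inter_subset_inter hU hV⟩

/-- `f` is continuous on some open dense subset of `X` (its values elsewhere are irrelevant). -/
def IsDenselyContinuous {X : Type*} [TopologicalSpace X] (f : X → ℝ) : Prop :=
  ∃ U : Set X, IsOpen U ∧ Dense U ∧ ContinuousOn f U

section IsDenselyContinuous

variable {X : Type*} [TopologicalSpace X] {f g : X → ℝ}

theorem IsDenselyContinuous.comp₂ (hf : IsDenselyContinuous f) (hg : IsDenselyContinuous g)
    {k : ℝ → ℝ → ℝ} (hk : Continuous fun p : ℝ × ℝ => k p.1 p.2) :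
    IsDenselyContinuous fun x => k (f x) (g x) := by
  obtain ⟨U, ho, hd, hU⟩ := hf
  obtain ⟨V, ho', hd', hV⟩ := hg
  exact ⟨U ∩ V, ho.inter ho', hd.inter_of_isOpen_left hd' ho,
    hk.comp_continuousOn ((hU.mono Set.inter_subset_left).prodMk (hV.mono Set.inter_subset_right))⟩

theorem Continuous.isDenselyContinuous (hf : Continuous f) : IsDenselyContinuous f :=
  ⟨Set.univ, isOpen_univ, dense_univ, hf.continuousOn⟩

end IsDenselyContinuous

/-- The space `S(X)` of equivalence classes of real functions that are defined and continuous on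
an open dense subset of `X`, two of them being equivalent when they agree on an open dense set
(see `SSpace.mk_eq_mk_iff`). It is realized inside the germs of functions `X → ℝ` along the filter
generated by the open dense sets; operations and order are pointwise on open dense sets. -/
def denselyContinuousGerms (X : Type*) [TopologicalSpace X] :
    Submodule ℝ (Germ (openDenseFilter X) ℝ) where
  carrier := {φ | ∃ f : X → ℝ, IsDenselyContinuous f ∧ (f : Germ (openDenseFilter X) ℝ) = φ}
  zero_mem' := ⟨fun _ => 0, continuous_const.isDenselyContinuous, rfl⟩
  add_mem' := by
    rintro _ _ ⟨f, hf, rfl⟩ ⟨g, hg, rfl⟩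
    exact ⟨fun x => f x + g x, hf.comp₂ hg (k := fun a b => a + b) (by fun_prop), rfl⟩
  smul_mem' := by
    rintro c _ ⟨f, hf, rfl⟩
    exact ⟨fun x => c * f x, hf.comp₂ hf (k := fun a _ => c * a) (by fun_prop), rfl⟩

/-- The vector lattice `S(X)`. -/
abbrev SSpace (X : Type*) [TopologicalSpace X] : Type _ := ↥(denselyContinuousGerms X)

namespace SSpace

variable {X : Type*} [TopologicalSpace X]

instance instLattice : Lattice (SSpace X) :=
  Subtype.lattice
    (by
      rintro _ _ ⟨f, hf, rfl⟩ ⟨g, hg, rfl⟩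
      exact ⟨fun x => f x ⊔ g x, hf.comp₂ hg (k := fun a b => a ⊔ b) (by fun_prop), rfl⟩)
    (by
      rintro _ _ ⟨f, hf, rfl⟩ ⟨g, hg, rfl⟩
      exact ⟨fun x => f x ⊓ g x, hf.comp₂ hg (k := fun a b => a ⊓ b) (by fun_prop), rfl⟩)

/-- The class in `S(X)` of a function that is continuous on an open dense set. -/
def mk (f : X → ℝ) (hf : IsDenselyContinuous f) : SSpace X := ⟨(f : Germ _ ℝ), f, hf, rfl⟩

/-- Two functions, continuous on the open dense sets `U` and `V`, represent the same element of
`S(X)` if and only if they agree on `U ∩ V`. -/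
theorem mk_eq_mk_iff {f g : X → ℝ} {U V : Set X} (hU : IsOpen U) (hU' : Dense U)
    (hf : ContinuousOn f U) (hV : IsOpen V) (hV' : Dense V) (hg : ContinuousOn g V) :
    mk f ⟨U, hU, hU', hf⟩ = mk g ⟨V, hV, hV', hg⟩ ↔ Set.EqOn f g (U ∩ V) := by
  refine Subtype.ext_iff.trans (Germ.coe_eq.trans ?_)
  constructor
  · rintro ⟨W, _, hW', h⟩ x hx
    by_contra hne
    have hfx : ContinuousAt f x := hf.continuousAt (hU.mem_nhds hx.1)
    have hgx : ContinuousAt g x := hg.continuousAt (hV.mem_nhds hx.2)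
    have hev : ∀ᶠ y in 𝓝 x, f y - g y ≠ 0 :=
      (hfx.sub hgx).eventually_ne (sub_ne_zero.2 hne)
    obtain ⟨y, hy, hyW⟩ := mem_closure_iff_nhds.1 (hW' x) _ hev
    exact hy (sub_eq_zero.2 (h hyW))
  · intro h
    exact ⟨U ∩ V, hU.inter hV, hU'.inter_of_isOpen_left hV' hU, h⟩

/-- The canonical map `C(X) → S(X)`. -/
def ofContinuous (f : C(X, ℝ)) : SSpace X := mk f f.continuous.isDenselyContinuous

/-- The identification of `∏ᵢ S(Xᵢ)` with `S(⊔ᵢ Xᵢ)`: the family `(φᵢ)` goes to the class of the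
function which, on each `Xᵢ`, is a representative of `φᵢ`. -/
def glue {ι : Type*} {X : ι → Type*} [∀ i, TopologicalSpace (X i)]
    (φ : ∀ i, SSpace (X i)) : SSpace (Σ i, X i) :=
  mk (fun p => (φ p.1).2.choose p.2) <| by
    choose U ho hd hU using fun i => (φ i).2.choose_spec.1
    have ho' : IsOpen {p : Σ i, X i | p.2 ∈ U p.1} := isOpen_sigma_iff.2 ho
    refine ⟨{p | p.2 ∈ U p.1}, ho', ?_, ?_⟩
    · rintro ⟨i, x⟩
      exact map_mem_closure (f := Sigma.mk i) continuous_sigmaMk (hd i x) (fun y hy => hy)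
    · rintro ⟨i, x⟩ hx
      refine ContinuousAt.continuousWithinAt ?_
      rw [IsOpenEmbedding.sigmaMk.continuousAt_iff.symm]
      exact (hU i).continuousAt ((ho i).mem_nhds hx)

end SSpace

/-! ### Vector lattices -/

/-- A linear map between vector lattices is a lattice homomorphism. -/
structure IsLatticeHom {E F : Type*} [Lattice E] [AddCommGroup E] [Module ℝ E]
    [Lattice F] [AddCommGroup F] [Module ℝ F] (T : E →ₗ[ℝ] F) : Prop where
  map_sup : ∀ x y, T (x ⊔ y) = T x ⊔ T y
  map_inf : ∀ x y, T (x ⊓ y) = T x ⊓ T y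

/-- An ideal of a vector lattice is a solid linear subspace. -/
def IsLatticeIdeal {E : Type*} [Lattice E] [AddCommGroup E] [Module ℝ E]
    (A : Submodule ℝ E) : Prop :=
  LatticeOrderedAddCommGroup.IsSolid (A : Set E)

/-- A band of a vector lattice is an order closed ideal. -/
structure Band (E : Type*) [Lattice E] [AddCommGroup E] [Module ℝ E]
    extends Submodule ℝ E where
  isLatticeIdeal : IsLatticeIdeal toSubmodule
  mem_of_isLUB : ∀ (s : Set E), (∀ x ∈ s, x ∈ toSubmodule) → ∀ a, IsLUB s a → a ∈ toSubmodule

namespace Band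

section Lattice

variable {E : Type*} [Lattice E] [AddCommGroup E] [IsOrderedAddMonoid E] [Module ℝ E]

theorem abs_mem (B : Band E) {x : E} (hx : x ∈ B.toSubmodule) : |x| ∈ B.toSubmodule :=
  B.isLatticeIdeal hx (abs_abs x).le

theorem mem_of_le_of_le (B : Band E) {x y z : E} (hx : x ∈ B.toSubmodule)
    (hz : z ∈ B.toSubmodule) (hxy : x ≤ y) (hyz : y ≤ z) : y ∈ B.toSubmodule := by
  have h : |y - x| ≤ |z - x| := by
    rw [abs_of_nonneg (sub_nonneg.2 hxy), abs_of_nonneg (sub_nonneg.2 (hxy.trans hyz))]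
    exact sub_le_sub_right hyz x
  have := B.toSubmodule.add_mem (B.isLatticeIdeal (B.toSubmodule.sub_mem hz hx) h) hx
  rwa [sub_add_cancel] at this

theorem sup_mem (B : Band E) {x y : E} (hx : x ∈ B.toSubmodule) (hy : y ∈ B.toSubmodule) :
    x ⊔ y ∈ B.toSubmodule :=
  B.mem_of_le_of_le hx (B.toSubmodule.add_mem (B.abs_mem hx) (B.abs_mem hy)) le_sup_left
    (sup_le ((le_abs_self x).trans (le_add_of_nonneg_right (abs_nonneg y)))
      ((le_abs_self y).trans (le_add_of_nonneg_left (abs_nonneg x))))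

theorem inf_mem (B : Band E) {x y : E} (hx : x ∈ B.toSubmodule) (hy : y ∈ B.toSubmodule) :
    x ⊓ y ∈ B.toSubmodule :=
  B.mem_of_le_of_le
    (B.toSubmodule.sub_mem (B.toSubmodule.neg_mem (B.abs_mem hx)) (B.abs_mem hy)) hx
    (le_inf ((sub_le_self _ (abs_nonneg y)).trans (neg_le.1 (neg_le_abs x)))
      (by
        rw [sub_eq_add_neg]
        exact (add_le_of_nonpos_left (neg_nonpos.2 (abs_nonneg x))).trans (neg_le.1 (neg_le_abs y))))
    inf_le_left

/-- A band is a vector lattice with the lattice operations of the ambient space. -/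
instance instLattice (B : Band E) : Lattice B.toSubmodule :=
  Subtype.lattice (fun _ _ hx hy => B.sup_mem hx hy) (fun _ _ hx hy => B.inf_mem hx hy)

end Lattice

section OrderComplete

variable {E : Type*} [ConditionallyCompleteLattice E] [AddCommGroup E] [IsOrderedAddMonoid E]
  [Module ℝ E]

/-- For `0 ≤ x`, the supremum of `B ∩ [0, x]`. -/
def projPos (B : Band E) (x : E) (hx : 0 ≤ x) : B.toSubmodule :=
  ⟨sSup {y | y ∈ B.toSubmodule ∧ 0 ≤ y ∧ y ≤ x},
    B.mem_of_isLUB _ (fun _ hy => hy.1) _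
      (isLUB_csSup ⟨0, B.toSubmodule.zero_mem, le_rfl, hx⟩ ⟨x, fun _ hy => hy.2.2⟩)⟩

/-- The band projection of an order complete vector lattice onto the band `B`, given by
`P x = sup (B ∩ [0, x])` for `0 ≤ x`, and by `P x = P x⁺ - P x⁻` in general. -/
def proj (B : Band E) (x : E) : B.toSubmodule :=
  B.projPos x⁺ (posPart_nonneg x) - B.projPos x⁻ (negPart_nonneg x)

end OrderComplete

end Band

/-! ### The representation -/

/-- `u` is a weak unit: `0 < u`, and only `0` is disjoint from `u`. -/
structure IsWeakUnit {E : Type*} [Lattice E] [AddCommGroup E] (u : E) : Prop where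
  pos : 0 < u
  eq_zero_of_disjoint : ∀ x : E, |x| ⊓ u = 0 → x = 0

/-- `T : E → S(X)` is a representation of the vector lattice `E` with weak unit `u`: it is a lattice
isomorphism onto its image, `T u = 1`, and `T` maps the ideal `E_u` generated by `u` onto a
subspace of `C(X)` whose closure for the sup norm is all of `C(X)` (for compact `X` the topology of
`C(X, ℝ)` is the sup norm topology). -/
structure IsUnitalRepresentation {E : Type*} [Lattice E] [AddCommGroup E] [Module ℝ E]
    {X : Type*} [TopologicalSpace X] [CompactSpace X] (u : E) (T : E →ₗ[ℝ] SSpace X) : Prop where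
  isLatticeHom : IsLatticeHom T
  injective : Function.Injective T
  map_unit : T u = SSpace.ofContinuous 1
  map_ideal : ∀ x : E, (∃ n : ℕ, |x| ≤ n • u) → ∃ f : C(X, ℝ), T x = SSpace.ofContinuous f
  dense_image :
    Dense {f : C(X, ℝ) | ∃ x : E, (∃ n : ℕ, |x| ≤ n • u) ∧ T x = SSpace.ofContinuous f}

/-- The data of which the representation of an order complete vector lattice `E` is made: a complete
disjoint system of bands `B i` with weak units `unit i`, and for each of them a compact Hausdorff
space `X i` with a representation `T i : B i → S(X i)`. -/
structure BandRepresentation (E : Type u) [ConditionallyCompleteLattice E] [AddCommGroup E]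
    [IsOrderedAddMonoid E] [Module ℝ E] where
  /-- the index set -/
  ι : Type v
  /-- the bands -/
  B : ι → Band E
  /-- the weak units -/
  unit : ∀ i, (B i).toSubmodule
  isWeakUnit : ∀ i, IsWeakUnit (unit i)
  disjoint : ∀ i j, i ≠ j → ∀ x ∈ (B i).toSubmodule, ∀ y ∈ (B j).toSubmodule, |x| ⊓ |y| = 0
  complete : ∀ x : E, (∀ i, ∀ y ∈ (B i).toSubmodule, |x| ⊓ |y| = 0) → x = 0
  /-- the compact Hausdorff spaces -/
  X : ι → Type w
  [topologicalSpace : ∀ i, TopologicalSpace (X i)]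
  [compactSpace : ∀ i, CompactSpace (X i)]
  [t2Space : ∀ i, T2Space (X i)]
  /-- the representations of the bands -/
  T : ∀ i, (B i).toSubmodule →ₗ[ℝ] SSpace (X i)
  isUnitalRepresentation : ∀ i, IsUnitalRepresentation (unit i) (T i)

namespace BandRepresentation

variable {E : Type u} [ConditionallyCompleteLattice E] [AddCommGroup E] [IsOrderedAddMonoid E]
  [Module ℝ E]

attribute [instance] topologicalSpace compactSpace t2Space

/-- The representation `E → S(⊔ᵢ Xᵢ) = ∏ᵢ S(Xᵢ)`, `x ↦ (Tᵢ (Pᵢ x))ᵢ`, where `Pᵢ` is the band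
projection onto `Bᵢ`. -/
def map (R : BandRepresentation.{u, v, w} E) (x : E) : SSpace (Σ i, R.X i) :=
  SSpace.glue fun i => R.T i ((R.B i).proj x)

end BandRepresentation

end

noncomputable section

/-! ### Generalities on vector lattices -/

section LatticeGroup

variable {E : Type*} [Lattice E] [AddCommGroup E] [IsOrderedAddMonoid E]

/-! The ideal property rests on order density of the image: every `ψ > 0` in `S(X)` dominates some
`T w` with `w > 0` (`exists_pos_mapₗ_le`). Indeed `ψ` exceeds some `ε > 0` on a nonempty open set,
which meets one summand; density of the image of the unit ideal in `C(Xᵢ)` supplies a bump function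
below `ε` supported there. If `0 ≤ φ ≤ T x`, order completeness yields `y = sup {z ≥ 0 | T z ≤ φ}`,
and a gap between `T y` and `φ` on either side would contain some `T w`, contradicting the choice of
`y` (`mem_range_of_nonneg_of_le`). Injectivity holds because an element with all band projections
zero is disjoint from every band.

For existence, Zorn's lemma gives a maximal disjoint system of positive elements, and the principal
bands they generate have them as weak units. In each band, `Xᵢ` is the compact space of unital real
lattice homomorphisms on the ideal generated by the unit `u`. Quotients by maximal ideals supply
enough of these to separate points (`exists_isUnitHom_pos`), and the lattice Stone–Weierstrass
theorem gives density in `C(Xᵢ)`. An arbitrary `x` has value `t` at `φ` when `|x - t • u| ⊓ u`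
vanishes at `φ`; the points where `x` has a value form an open set on which the value is continuous,
and by the Archimedean property this set is dense (`dense_setOf_hasValue`). -/

theorem inf_add_le_add_inf {a b c : E} (ha : 0 ≤ a) (hb : 0 ≤ b) (hc : 0 ≤ c) :
    a ⊓ (b + c) ≤ a ⊓ b + a ⊓ c := by
  rw [inf_add, add_inf, add_inf]
  refine le_inf (le_inf ?_ ?_) (le_inf ?_ inf_le_right)
  · exact inf_le_left.trans (le_add_of_nonneg_left ha)
  · exact inf_le_left.trans (le_add_of_nonneg_right hc)
  · exact inf_le_left.trans (le_add_of_nonneg_left hb)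

theorem inf_nsmul_le_nsmul_inf {a b : E} (ha : 0 ≤ a) (hb : 0 ≤ b) (n : ℕ) :
    a ⊓ n • b ≤ n • (a ⊓ b) := by
  induction n with
  | zero => simp
  | succ n ih =>
    rw [succ_nsmul, succ_nsmul]
    exact (inf_add_le_add_inf ha (nsmul_nonneg hb n) hb).trans (add_le_add_left ih _)

theorem inf_nsmul_eq_zero {a b : E} (ha : 0 ≤ a) (hb : 0 ≤ b) (h : a ⊓ b = 0) (n : ℕ) :
    a ⊓ n • b = 0 :=
  le_antisymm ((inf_nsmul_le_nsmul_inf ha hb n).trans (by simp [h]))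
    (le_inf ha (nsmul_nonneg hb n))

theorem abs_sup_sub_sup_le_add (a b c d : E) : |a ⊔ b - c ⊔ d| ≤ |a - c| + |b - d| := by
  have h : a ⊔ b - c ⊔ d = (a ⊔ b - c ⊔ b) + (b ⊔ c - d ⊔ c) := by
    rw [sup_comm b c, sup_comm d c]; abel
  rw [h]
  exact (abs_add_le _ _).trans
    (add_le_add (abs_sup_sub_sup_le_abs a c b) (abs_sup_sub_sup_le_abs b d c))

theorem abs_inf_sub_inf_le_add (a b c d : E) : |a ⊓ b - c ⊓ d| ≤ |a - c| + |b - d| := by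
  have h : a ⊓ b - c ⊓ d = (a ⊓ b - c ⊓ b) + (b ⊓ c - d ⊓ c) := by
    rw [inf_comm b c, inf_comm d c]; abel
  rw [h]
  exact (abs_add_le _ _).trans
    (add_le_add (abs_inf_sub_inf_le_abs a c b) (abs_inf_sub_inf_le_abs b d c))

theorem eq_zero_of_abs_inf_abs_self {x : E} (h : |x| ⊓ |x| = 0) : x = 0 := by
  rw [inf_idem] at h
  exact le_antisymm (h ▸ le_abs_self x) (neg_nonpos.1 (h ▸ neg_le_abs x))

end LatticeGroup

/-- Rounding `|c|` up to a natural number lets a solid set closed under addition absorb real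
scalars. -/
theorem abs_smul_le_nsmul {E : Type*} [Lattice E] [AddCommGroup E] [IsOrderedAddMonoid E]
    [Module ℝ E] [IsOrderedModule ℝ E] (c : ℝ) (x : E) : |c • x| ≤ ⌈|c|⌉₊ • |x| := by
  have key : ∀ z : E, z ≤ |x| → -z ≤ |x| → c • z ≤ ⌈|c|⌉₊ • |x| := by
    intro z hz hz'
    have hle : |c| • |x| ≤ ⌈|c|⌉₊ • |x| := by
      rw [← Nat.cast_smul_eq_nsmul ℝ]
      exact smul_le_smul_of_nonneg_right (Nat.le_ceil _) (abs_nonneg x)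
    refine le_trans ?_ hle
    rcases le_total 0 c with hc | hc
    · rw [abs_of_nonneg hc]
      exact smul_le_smul_of_nonneg_left hz hc
    · rw [abs_of_nonpos hc]
      have := smul_le_smul_of_nonneg_left hz' (neg_nonneg.2 hc)
      rwa [smul_neg, neg_smul, neg_neg] at this
  refine abs_le'.2 ⟨key x (le_abs_self x) (neg_le_abs x), ?_⟩
  rw [← smul_neg]
  exact key (-x) (neg_le_abs x) (by rw [neg_neg]; exact le_abs_self x)

section VectorLattice

variable {E : Type*} [Lattice E] [AddCommGroup E] [IsOrderedAddMonoid E]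
  [Module ℝ E] [IsOrderedModule ℝ E]

/-- A solid set containing `0` and closed under addition, as a linear subspace. -/
def solidSubmodule (S : Set E) (zero : (0 : E) ∈ S) (add : ∀ x ∈ S, ∀ y ∈ S, x + y ∈ S)
    (solid : ∀ x ∈ S, ∀ y, |y| ≤ |x| → y ∈ S) : Submodule ℝ E where
  carrier := S
  zero_mem' := zero
  add_mem' := fun hx hy => add _ hx _ hy
  smul_mem' := by
    intro c x hx
    have hn : ∀ n : ℕ, n • |x| ∈ S := by
      intro n
      induction n with
      | zero => simpa using zero
      | succ n ih =>
        rw [succ_nsmul]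
        exact add _ ih _ (solid x hx _ (abs_abs x).le)
    refine solid _ (hn ⌈|c|⌉₊) _ ?_
    rw [abs_of_nonneg (nsmul_nonneg (abs_nonneg x) _)]
    exact abs_smul_le_nsmul c x

/-- The elements of `E` disjoint from all elements of `S`. -/
def disjointCompl (S : Set E) : Submodule ℝ E :=
  solidSubmodule {x | ∀ y ∈ S, |x| ⊓ |y| = 0}
    (fun y _ => by rw [abs_zero]; exact inf_of_le_left (abs_nonneg y))
    (fun x hx z hz y hy => by
      refine le_antisymm ?_ (le_inf (abs_nonneg _) (abs_nonneg _))
      calc |x + z| ⊓ |y| ≤ |y| ⊓ (|x| + |z|) :=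
            (inf_le_inf_right _ (abs_add_le x z)).trans (inf_comm _ _).le
        _ ≤ |y| ⊓ |x| + |y| ⊓ |z| :=
            inf_add_le_add_inf (abs_nonneg y) (abs_nonneg x) (abs_nonneg z)
        _ = 0 := by rw [inf_comm, hx y hy, inf_comm, hz y hy, add_zero])
    (fun x hx z hz y hy => le_antisymm ((inf_le_inf_right _ hz).trans (hx y hy).le)
      (le_inf (abs_nonneg _) (abs_nonneg _)))

theorem mem_disjointCompl_of_abs_le {S : Set E} {x y : E} (hx : x ∈ disjointCompl S)
    (h : |y| ≤ |x|) : y ∈ disjointCompl S := fun z hz =>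
  le_antisymm ((inf_le_inf_right _ h).trans (hx z hz).le) (le_inf (abs_nonneg _) (abs_nonneg _))

theorem disjoint_submodule_disjointCompl (B : Submodule ℝ E) :
    Disjoint B (disjointCompl (B : Set E)) := by
  rw [Submodule.disjoint_def]
  exact fun x hx hx' => eq_zero_of_abs_inf_abs_self (hx' x hx)

/-- The ideal generated by `u ≥ 0`. -/
def orderIdeal (u : E) : Submodule ℝ E :=
  solidSubmodule {x | ∃ n : ℕ, |x| ≤ n • u} ⟨0, by simp⟩
    (fun x ⟨n, hn⟩ y ⟨m, hm⟩ => ⟨n + m, by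
      rw [add_nsmul]; exact (abs_add_le x y).trans (add_le_add hn hm)⟩)
    (fun _ ⟨n, hn⟩ _ h => ⟨n, h.trans hn⟩)

theorem mem_orderIdeal_of_abs_le {u x y : E} (hx : x ∈ orderIdeal u) (h : |y| ≤ |x|) :
    y ∈ orderIdeal u := let ⟨n, hn⟩ := hx; ⟨n, h.trans hn⟩

end VectorLattice

/-! ### Band projections -/

namespace Band

variable {E : Type*} [ConditionallyCompleteLattice E] [AddCommGroup E] [IsOrderedAddMonoid E]
  [Module ℝ E]

theorem isLUB_projPos (B : Band E) {x : E} (hx : 0 ≤ x) :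
    IsLUB {y | y ∈ B.toSubmodule ∧ 0 ≤ y ∧ y ≤ x} (B.projPos x hx : E) :=
  isLUB_csSup ⟨0, B.toSubmodule.zero_mem, le_rfl, hx⟩ ⟨x, fun _ hy => hy.2.2⟩

theorem projPos_nonneg (B : Band E) {x : E} (hx : 0 ≤ x) : 0 ≤ (B.projPos x hx : E) :=
  (B.isLUB_projPos hx).1 ⟨B.toSubmodule.zero_mem, le_rfl, hx⟩

theorem projPos_le (B : Band E) {x : E} (hx : 0 ≤ x) : (B.projPos x hx : E) ≤ x :=
  (B.isLUB_projPos hx).2 fun _ hy => hy.2.2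

variable [IsOrderedModule ℝ E]

/-- With `p` the projection, any part of `x - p` below some `|y|`, `y ∈ B`, lies in `B` and can be
added to `p` without exceeding `x`; since `p` is the supremum, that part is zero. -/
theorem sub_projPos_mem (B : Band E) {x : E} (hx : 0 ≤ x) :
    x - (B.projPos x hx : E) ∈ disjointCompl (B.toSubmodule : Set E) := by
  intro y hy
  have h0 : 0 ≤ x - (B.projPos x hx : E) := sub_nonneg.2 (B.projPos_le hx)
  rw [abs_of_nonneg h0]
  set p : E := (B.projPos x hx : E) with hp
  have hc0 : 0 ≤ (x - p) ⊓ |y| := le_inf h0 (abs_nonneg y)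
  have hc : (x - p) ⊓ |y| ∈ B.toSubmodule :=
    B.mem_of_le_of_le B.toSubmodule.zero_mem (B.abs_mem hy) hc0 inf_le_right
  have : p + (x - p) ⊓ |y| ≤ p := by
    refine (B.isLUB_projPos hx).1
      ⟨B.toSubmodule.add_mem (B.projPos x hx).2 hc, add_nonneg (B.projPos_nonneg hx) hc0, ?_⟩
    calc p + (x - p) ⊓ |y| ≤ p + (x - p) := add_le_add_right inf_le_left _
      _ = x := by abel
  exact le_antisymm (by simpa using this) hc0

theorem sub_proj_mem (B : Band E) (x : E) :
    x - (B.proj x : E) ∈ disjointCompl (B.toSubmodule : Set E) := by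
  have := (disjointCompl (B.toSubmodule : Set E)).sub_mem
    (B.sub_projPos_mem (posPart_nonneg x)) (B.sub_projPos_mem (negPart_nonneg x))
  rwa [sub_sub_sub_comm, posPart_sub_negPart] at this

/-- A band meets its disjoint complement only in `0`, so the decomposition of `x` is unique.
Linearity and the lattice identities of the projection are all read off from this. -/
theorem proj_eq (B : Band E) {x : E} {p : B.toSubmodule}
    (h : x - (p : E) ∈ disjointCompl (B.toSubmodule : Set E)) : B.proj x = p := by
  have h1 := (disjointCompl (B.toSubmodule : Set E)).sub_mem h (B.sub_proj_mem x)
  rw [sub_sub_sub_cancel_left] at h1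
  have := Submodule.disjoint_def.1 (disjoint_submodule_disjointCompl B.toSubmodule) _
    (B.toSubmodule.sub_mem (B.proj x).2 p.2) h1
  exact Subtype.ext (sub_eq_zero.1 this)

/-- The band projection as a linear map. -/
def projₗ (B : Band E) : E →ₗ[ℝ] B.toSubmodule where
  toFun := B.proj
  map_add' x y := B.proj_eq (by
    have := (disjointCompl (B.toSubmodule : Set E)).add_mem (B.sub_proj_mem x) (B.sub_proj_mem y)
    rwa [← add_sub_add_comm] at this)
  map_smul' c x := B.proj_eq (by
    have := (disjointCompl (B.toSubmodule : Set E)).smul_mem c (B.sub_proj_mem x)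
    rwa [smul_sub] at this)

/-- The error of the candidate is at most the sum of the absolute errors for `x` and `y`, and the
disjoint complement is solid. -/
theorem proj_sup (B : Band E) (x y : E) : B.proj (x ⊔ y) = B.proj x ⊔ B.proj y := by
  refine B.proj_eq (mem_disjointCompl_of_abs_le (Submodule.add_mem _
    (mem_disjointCompl_of_abs_le (B.sub_proj_mem x) (abs_abs _).le)
    (mem_disjointCompl_of_abs_le (B.sub_proj_mem y) (abs_abs _).le)) ?_)
  rw [abs_of_nonneg (add_nonneg (abs_nonneg (x - (B.proj x : E))) (abs_nonneg _))]
  exact abs_sup_sub_sup_le_add _ _ _ _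

theorem proj_inf (B : Band E) (x y : E) : B.proj (x ⊓ y) = B.proj x ⊓ B.proj y := by
  refine B.proj_eq (mem_disjointCompl_of_abs_le (Submodule.add_mem _
    (mem_disjointCompl_of_abs_le (B.sub_proj_mem x) (abs_abs _).le)
    (mem_disjointCompl_of_abs_le (B.sub_proj_mem y) (abs_abs _).le)) ?_)
  rw [abs_of_nonneg (add_nonneg (abs_nonneg (x - (B.proj x : E))) (abs_nonneg _))]
  exact abs_inf_sub_inf_le_add _ _ _ _

theorem proj_coe (B : Band E) (x : B.toSubmodule) : B.proj (x : E) = x :=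
  B.proj_eq (by simp)

theorem proj_eq_zero (B : Band E) {x : E} (h : x ∈ disjointCompl (B.toSubmodule : Set E)) :
    B.proj x = 0 := B.proj_eq (by simpa using h)

theorem mem_disjointCompl_of_proj_eq_zero (B : Band E) {x : E} (h : B.proj x = 0) :
    x ∈ disjointCompl (B.toSubmodule : Set E) := by
  simpa [h] using B.sub_proj_mem x

end Band

/-! ### Lattice homomorphisms with order dense range -/

section OrderDense

variable {E F : Type*} [Lattice F] [AddCommGroup F] [IsOrderedAddMonoid F] [Module ℝ F]

theorem IsLatticeHom.map_le_map_iff [Lattice E] [AddCommGroup E] [Module ℝ E] {T : E →ₗ[ℝ] F}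
    (hT : IsLatticeHom T) (hi : Function.Injective T) {x y : E} : T x ≤ T y ↔ x ≤ y := by
  rw [← sup_eq_right, ← hT.map_sup, hi.eq_iff, sup_eq_right]

theorem IsLatticeHom.map_abs [Lattice E] [AddCommGroup E] [Module ℝ E] {T : E →ₗ[ℝ] F}
    (hT : IsLatticeHom T) (x : E) : T |x| = |T x| := by
  simp only [abs, hT.map_sup, map_neg]

/-- An element of `F` that lies between `0` and an element of the order dense range of an injective
lattice homomorphism `T`, defined on an order complete vector lattice, lies in the range. -/
theorem IsLatticeHom.mem_range_of_nonneg_of_le [ConditionallyCompleteLattice E] [AddCommGroup E]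
    [IsOrderedAddMonoid E] [Module ℝ E] {T : E →ₗ[ℝ] F} (hT : IsLatticeHom T)
    (hi : Function.Injective T) (hd : ∀ ψ : F, 0 < ψ → ∃ w : E, 0 < w ∧ T w ≤ ψ)
    {φ : F} {x : E} (h0 : 0 ≤ φ) (hx : φ ≤ T x) : φ ∈ LinearMap.range T := by
  set A : Set E := {z | 0 ≤ z ∧ T z ≤ φ} with hA
  have hbdd : BddAbove A := ⟨x, fun z hz => (hT.map_le_map_iff hi).1 (hz.2.trans hx)⟩
  have hy : IsLUB A (sSup A) := isLUB_csSup ⟨0, le_rfl, by simpa using h0⟩ hbdd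
  set y := sSup A
  refine ⟨y, le_antisymm ?_ ?_⟩
  · by_contra hlt
    have hpos : 0 < (T y - φ)⁺ := lt_of_le_of_ne (posPart_nonneg _) fun h =>
      hlt (sub_nonpos.1 (posPart_eq_zero.1 h.symm))
    obtain ⟨w, hw, hwle⟩ := hd _ hpos
    -- Each `z ∈ A` has `T z ≤ φ` and `z ≤ y`, so `T w ≤ (T y - φ)⁺ ≤ T y - T z`: thus `y - w` is
    -- still an upper bound of `A`.
    have : y ≤ y - w := hy.2 fun z hz => by
      rw [← hT.map_le_map_iff hi, map_sub, le_sub_comm]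
      refine hwle.trans (sup_le ?_ ?_)
      · exact sub_le_sub_left hz.2 _
      · exact sub_nonneg.2 ((hT.map_le_map_iff hi).2 (hy.1 hz))
    exact absurd hw (not_lt_of_ge (by simpa using this))
  · by_contra hlt
    have hpos : 0 < (φ - T y)⁺ := lt_of_le_of_ne (posPart_nonneg _) fun h =>
      hlt (sub_nonpos.1 (posPart_eq_zero.1 h.symm))
    obtain ⟨w, hw, hwle⟩ := hd _ hpos
    -- Here `T w ≤ (φ - T y)⁺ ≤ φ - T z`, so `A` is stable under adding `w`.
    have : y ≤ y - w := hy.2 fun z hz => by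
      rw [le_sub_iff_add_le]
      refine hy.1 ⟨add_nonneg hz.1 hw.le, ?_⟩
      rw [map_add, ← le_sub_iff_add_le']
      refine hwle.trans (sup_le ?_ ?_)
      · exact sub_le_sub_left ((hT.map_le_map_iff hi).2 (hy.1 hz)) _
      · exact sub_nonneg.2 hz.2
    exact absurd hw (not_lt_of_ge (by simpa using this))

theorem IsLatticeHom.isLatticeIdeal_range [ConditionallyCompleteLattice E] [AddCommGroup E]
    [IsOrderedAddMonoid E] [Module ℝ E] {T : E →ₗ[ℝ] F} (hT : IsLatticeHom T)
    (hi : Function.Injective T) (hd : ∀ ψ : F, 0 < ψ → ∃ w : E, 0 < w ∧ T w ≤ ψ) :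
    IsLatticeIdeal (LinearMap.range T) := by
  rintro _ ⟨x, rfl⟩ φ hφ
  rw [← hT.map_abs] at hφ
  have hp := hT.mem_range_of_nonneg_of_le hi hd (posPart_nonneg φ) ((sup_le (le_abs_self φ)
    (abs_nonneg φ)).trans hφ)
  have hn := hT.mem_range_of_nonneg_of_le hi hd (negPart_nonneg φ) ((sup_le (neg_le_abs φ)
    (abs_nonneg φ)).trans hφ)
  rw [← posPart_sub_negPart φ]
  exact Submodule.sub_mem _ hp hn

end OrderDense

/-! ### The space `S(X)` -/

section SSpace

/-- The inclusions of the summands are continuous and open, so open dense sets restrict to each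
summand and reassemble from the summands. This reduces every statement about glued classes to the
components. -/
theorem eventually_openDenseFilter_sigma {ι : Type*} {X : ι → Type*} [∀ i, TopologicalSpace (X i)]
    {p : (Σ i, X i) → Prop} :
    (∀ᶠ z in openDenseFilter (Σ i, X i), p z) ↔
      ∀ i, ∀ᶠ x in openDenseFilter (X i), p ⟨i, x⟩ := by
  constructor
  · rintro ⟨U, ho, hd, hU⟩ i
    exact ⟨Sigma.mk i ⁻¹' U, ho.preimage continuous_sigmaMk,
      hd.preimage isOpenMap_sigmaMk, fun x hx => hU hx⟩
  · intro h
    choose U ho hd hU using h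
    refine ⟨{z | z.2 ∈ U z.1}, isOpen_sigma_iff.2 ho, ?_, fun z hz => hU z.1 hz⟩
    rintro ⟨i, x⟩
    exact map_mem_closure (f := Sigma.mk i) continuous_sigmaMk (hd i x) (fun y hy => hy)

namespace SSpace

variable {X : Type*} [TopologicalSpace X]

instance instIsOrderedAddMonoid : IsOrderedAddMonoid (SSpace X) where
  add_le_add_left _ _ h c := add_le_add_left (α := Germ (openDenseFilter X) ℝ) h c

/-- A representative of an element of `S(X)`. -/
def repr (φ : SSpace X) : X → ℝ := φ.2.choose

theorem isDenselyContinuous_repr (φ : SSpace X) : IsDenselyContinuous φ.repr := φ.2.choose_spec.1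

theorem mk_repr (φ : SSpace X) : mk φ.repr φ.isDenselyContinuous_repr = φ :=
  Subtype.ext φ.2.choose_spec.2

theorem mk_eq_mk {f g : X → ℝ} {hf : IsDenselyContinuous f} {hg : IsDenselyContinuous g} :
    mk f hf = mk g hg ↔ f =ᶠ[openDenseFilter X] g :=
  Subtype.ext_iff.trans Germ.coe_eq

theorem mk_le_mk {f g : X → ℝ} {hf : IsDenselyContinuous f} {hg : IsDenselyContinuous g} :
    mk f hf ≤ mk g hg ↔ f ≤ᶠ[openDenseFilter X] g := Germ.coe_le

theorem repr_mk {f : X → ℝ} (hf : IsDenselyContinuous f) :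
    (mk f hf).repr =ᶠ[openDenseFilter X] f := mk_eq_mk.1 (mk_repr (mk f hf))

theorem repr_add (φ ψ : SSpace X) : (φ + ψ).repr =ᶠ[openDenseFilter X] φ.repr + ψ.repr :=
  Germ.coe_eq.1 ((φ + ψ).2.choose_spec.2.trans
    (congrArg₂ (· + ·) φ.2.choose_spec.2 ψ.2.choose_spec.2).symm)

theorem repr_smul (c : ℝ) (φ : SSpace X) : (c • φ).repr =ᶠ[openDenseFilter X] c • φ.repr :=
  Germ.coe_eq.1 ((c • φ).2.choose_spec.2.trans
    (congrArg (c • ·) φ.2.choose_spec.2).symm)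

theorem repr_sup (φ ψ : SSpace X) : (φ ⊔ ψ).repr =ᶠ[openDenseFilter X] φ.repr ⊔ ψ.repr :=
  Germ.coe_eq.1 ((φ ⊔ ψ).2.choose_spec.2.trans
    (congrArg₂ (· ⊔ ·) φ.2.choose_spec.2 ψ.2.choose_spec.2).symm)

theorem repr_inf (φ ψ : SSpace X) : (φ ⊓ ψ).repr =ᶠ[openDenseFilter X] φ.repr ⊓ ψ.repr :=
  Germ.coe_eq.1 ((φ ⊓ ψ).2.choose_spec.2.trans
    (congrArg₂ (· ⊓ ·) φ.2.choose_spec.2 ψ.2.choose_spec.2).symm)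

theorem repr_zero : (0 : SSpace X).repr =ᶠ[openDenseFilter X] 0 :=
  Germ.coe_eq.1 (0 : SSpace X).2.choose_spec.2

theorem le_iff_repr {φ ψ : SSpace X} : φ ≤ ψ ↔ φ.repr ≤ᶠ[openDenseFilter X] ψ.repr := by
  conv_lhs => rw [← mk_repr φ, ← mk_repr ψ, mk_le_mk]

theorem ofContinuous_injective : Function.Injective (ofContinuous (X := X)) := by
  intro f g h
  ext x
  exact (mk_eq_mk_iff isOpen_univ dense_univ f.continuous.continuousOn isOpen_univ dense_univ
    g.continuous.continuousOn).1 h ⟨trivial, trivial⟩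

section Glue

variable {ι : Type*} {X : ι → Type*} [∀ i, TopologicalSpace (X i)]

theorem glue_eq (φ : ∀ i, SSpace (X i)) {f : (Σ i, X i) → ℝ} (hf : IsDenselyContinuous f)
    (h : ∀ i, (φ i).repr =ᶠ[openDenseFilter (X i)] fun x => f ⟨i, x⟩) : glue φ = mk f hf :=
  mk_eq_mk.2 (eventually_openDenseFilter_sigma.2 h)

theorem repr_glue (φ : ∀ i, SSpace (X i)) (i : ι) :
    (fun x => (glue φ).repr ⟨i, x⟩) =ᶠ[openDenseFilter (X i)] (φ i).repr :=
  eventually_openDenseFilter_sigma.1 (repr_mk _) i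

theorem glue_eq_of_repr (φ : ∀ i, SSpace (X i)) {ψ : SSpace (Σ i, X i)}
    (h : ∀ i, (φ i).repr =ᶠ[openDenseFilter (X i)] fun x => ψ.repr ⟨i, x⟩) : glue φ = ψ :=
  (glue_eq φ ψ.isDenselyContinuous_repr h).trans ψ.mk_repr

theorem glue_add (φ ψ : ∀ i, SSpace (X i)) :
    glue (fun i => φ i + ψ i) = glue φ + glue ψ := by
  refine glue_eq_of_repr _ fun i => ?_
  filter_upwards [repr_add (φ i) (ψ i), repr_glue φ i, repr_glue ψ i,
    eventually_openDenseFilter_sigma.1 (repr_add (glue φ) (glue ψ)) i] with x h1 h2 h3 h4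
  rw [h1, h4, Pi.add_apply, Pi.add_apply, h2, h3]

theorem glue_smul (c : ℝ) (φ : ∀ i, SSpace (X i)) :
    glue (fun i => c • φ i) = c • glue φ := by
  refine glue_eq_of_repr _ fun i => ?_
  filter_upwards [repr_smul c (φ i), repr_glue φ i,
    eventually_openDenseFilter_sigma.1 (repr_smul c (glue φ)) i] with x h1 h2 h4
  rw [h1, h4, Pi.smul_apply, Pi.smul_apply, h2]

theorem glue_sup (φ ψ : ∀ i, SSpace (X i)) :
    glue (fun i => φ i ⊔ ψ i) = glue φ ⊔ glue ψ := by
  refine glue_eq_of_repr _ fun i => ?_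
  filter_upwards [repr_sup (φ i) (ψ i), repr_glue φ i, repr_glue ψ i,
    eventually_openDenseFilter_sigma.1 (repr_sup (glue φ) (glue ψ)) i] with x h1 h2 h3 h4
  rw [h1, h4, Pi.sup_apply, Pi.sup_apply, h2, h3]

theorem glue_inf (φ ψ : ∀ i, SSpace (X i)) :
    glue (fun i => φ i ⊓ ψ i) = glue φ ⊓ glue ψ := by
  refine glue_eq_of_repr _ fun i => ?_
  filter_upwards [repr_inf (φ i) (ψ i), repr_glue φ i, repr_glue ψ i,
    eventually_openDenseFilter_sigma.1 (repr_inf (glue φ) (glue ψ)) i] with x h1 h2 h3 h4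
  rw [h1, h4, Pi.inf_apply, Pi.inf_apply, h2, h3]

theorem glue_le_iff {φ : ∀ i, SSpace (X i)} {ψ : SSpace (Σ i, X i)} :
    glue φ ≤ ψ ↔ ∀ i, (φ i).repr ≤ᶠ[openDenseFilter (X i)] fun x => ψ.repr ⟨i, x⟩ := by
  conv_lhs => rw [← mk_repr ψ]
  exact mk_le_mk.trans eventually_openDenseFilter_sigma

theorem glue_injective : Function.Injective (glue (X := X)) := by
  intro φ ψ h
  funext i
  rw [← mk_repr (φ i), ← mk_repr (ψ i), mk_eq_mk]
  exact (repr_glue φ i).symm.trans (by rw [h]; exact repr_glue ψ i)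

end Glue

/-- A positive element of `S(X)` exceeds some `ε > 0` on some nonempty open set. -/
theorem exists_isOpen_lt_repr {φ : SSpace X} (h : 0 < φ) :
    ∃ ε > 0, ∃ V : Set X, IsOpen V ∧ V.Nonempty ∧ ∀ x ∈ V, ε < φ.repr x := by
  obtain ⟨U, ho, hd, hU⟩ := φ.isDenselyContinuous_repr
  have : ∃ p ∈ U, 0 < φ.repr p := by
    by_contra! hle
    refine h.not_ge (le_iff_repr.2 ?_)
    filter_upwards [repr_zero (X := X), show U ∈ openDenseFilter X from ⟨U, ho, hd, subset_rfl⟩]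
      with x hx hxU
    rw [hx]
    exact hle x hxU
  obtain ⟨p, hp, hpos⟩ := this
  refine ⟨φ.repr p / 2, half_pos hpos, U ∩ φ.repr ⁻¹' Set.Ioi (φ.repr p / 2),
    hU.isOpen_inter_preimage ho isOpen_Ioi, ⟨p, hp, half_lt_self hpos⟩, fun x hx => hx.2⟩

end SSpace

end SSpace

/-! ### Bump functions in the image of a unital representation -/

/-- A dense set of continuous functions on a compact Hausdorff space contains approximate bump
functions. -/
theorem Dense.exists_bump {X : Type*} [TopologicalSpace X] [CompactSpace X] [T2Space X]
    {D : Set C(X, ℝ)} (hD : Dense D) {V : Set X} (hV : IsOpen V) {p : X} (hp : p ∈ V) :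
    ∃ f ∈ D, 1 / 2 < f p ∧ (∀ x, f x ≤ 3 / 2) ∧ ∀ x ∉ V, f x ≤ 1 / 2 := by
  obtain ⟨g, hg0, hg1, hg⟩ := exists_continuous_zero_one_of_isClosed (hV.isClosed_compl)
    (isClosed_singleton (x := p)) (Set.disjoint_singleton_right.2 (by simpa using hp))
  -- Any error below `1 / 2` in approximating the Urysohn function `g` would give the three bounds.
  obtain ⟨f, hf, hfg⟩ := hD.exists_dist_lt g (ε := 1 / 4) (by norm_num)
  have hd : ∀ x, |g x - f x| < 1 / 4 := fun x =>
    (ContinuousMap.dist_apply_le_dist x).trans_lt hfg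
  refine ⟨f, hf, ?_, fun x => ?_, fun x hx => ?_⟩
  · have := (abs_lt.1 (hd p)).2
    rw [hg1 rfl, Pi.one_apply] at this
    linarith
  · have := (abs_lt.1 (hd x)).1
    have := (hg x).2
    linarith
  · have := (abs_lt.1 (hd x)).1
    rw [hg0 hx, Pi.zero_apply] at this
    linarith

theorem IsUnitalRepresentation.exists_pos {E : Type*} [Lattice E] [AddCommGroup E]
    [IsOrderedAddMonoid E] [Module ℝ E]
    {X : Type*} [TopologicalSpace X] [CompactSpace X] [T2Space X] {u : E} {T : E →ₗ[ℝ] SSpace X}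
    (hT : IsUnitalRepresentation u T) {ε : ℝ} (hε : 0 < ε) {V : Set X} (hV : IsOpen V)
    (hne : V.Nonempty) :
    ∃ w : E, 0 < w ∧ ∃ f : C(X, ℝ), T w = SSpace.ofContinuous f ∧ (∀ x, f x ≤ ε) ∧
      ∀ x ∉ V, f x = 0 := by
  obtain ⟨p, hp⟩ := hne
  obtain ⟨f, ⟨a, -, ha⟩, hfp, hf, hfV⟩ := hT.dense_image.exists_bump hV hp
  -- Cutting off at height `1 / 2` turns the approximate bump into one vanishing exactly outside
  -- `V`; the bound `3 / 2` on `f` keeps it below `ε`. As `T u = 1`, the same formula applied to `a`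
  -- and `u` gives a preimage.
  set g : C(X, ℝ) := ε • ((f - (1 / 2 : ℝ) • 1) ⊔ 0) with hg
  have hgx : ∀ x, g x = ε * max (f x - 1 / 2) 0 := fun x => by simp [hg]
  set w : E := ε • ((a - (1 / 2 : ℝ) • u) ⊔ 0) with hw
  have hTw : T w = SSpace.ofContinuous g := by
    rw [hw, map_smul, hT.isLatticeHom.map_sup, map_sub, map_smul, hT.map_unit, ha, map_zero]
    rfl
  refine ⟨w, ?_, g, hTw, fun x => ?_, fun x hx => ?_⟩
  · have hle : (0 : E) ≤ w := by
      rw [← hT.isLatticeHom.map_le_map_iff hT.injective, hTw, map_zero]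
      exact SSpace.mk_le_mk (f := fun _ => 0) (hf := continuous_const.isDenselyContinuous).2
        (Eventually.of_forall fun x => by
          show (0 : ℝ) ≤ g x
          rw [hgx]; positivity)
    refine lt_of_le_of_ne hle fun h => ?_
    have h0 : SSpace.ofContinuous g = SSpace.ofContinuous 0 := by
      rw [← hTw, ← h, map_zero]; rfl
    have := DFunLike.congr_fun (SSpace.ofContinuous_injective h0) p
    rw [hgx, max_eq_left (by linarith), ContinuousMap.zero_apply] at this
    rcases mul_eq_zero.1 this with h | h <;> linarith
  · rw [hgx]
    have : max (f x - 1 / 2) 0 ≤ 1 := max_le (by linarith [hf x]) zero_le_one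
    nlinarith
  · rw [hgx, max_eq_right (by linarith [hfV x hx]), mul_zero]

/-! ### Every representation is an injective lattice homomorphism onto an ideal -/

namespace BandRepresentation

variable {E : Type u} [ConditionallyCompleteLattice E] [AddCommGroup E] [IsOrderedAddMonoid E]
  [Module ℝ E] [IsOrderedModule ℝ E] (R : BandRepresentation.{u, v, w} E)

/-- `BandRepresentation.map` as a linear map. -/
def mapₗ : E →ₗ[ℝ] SSpace (Σ i, R.X i) where
  toFun := R.map
  map_add' x y := by
    rw [map, map, map, ← SSpace.glue_add]
    exact congrArg _ (funext fun i => by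
      rw [← map_add]; exact congrArg _ ((R.B i).projₗ.map_add x y))
  map_smul' c x := by
    rw [map, map, RingHom.id_apply, ← SSpace.glue_smul]
    exact congrArg _ (funext fun i => by
      rw [← map_smul]; exact congrArg _ ((R.B i).projₗ.map_smul c x))

theorem isLatticeHom_mapₗ : IsLatticeHom R.mapₗ where
  map_sup x y := by
    change R.map (x ⊔ y) = R.map x ⊔ R.map y
    rw [map, map, map, ← SSpace.glue_sup]
    exact congrArg _ (funext fun i => by
      rw [Band.proj_sup, (R.isUnitalRepresentation i).isLatticeHom.map_sup])
  map_inf x y := by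
    change R.map (x ⊓ y) = R.map x ⊓ R.map y
    rw [map, map, map, ← SSpace.glue_inf]
    exact congrArg _ (funext fun i => by
      rw [Band.proj_inf, (R.isUnitalRepresentation i).isLatticeHom.map_inf])

theorem mapₗ_injective : Function.Injective R.mapₗ := by
  rw [injective_iff_map_eq_zero]
  intro x hx
  have h0 : R.map x = R.map 0 := hx.trans (map_zero R.mapₗ).symm
  refine R.complete x fun i => (R.B i).mem_disjointCompl_of_proj_eq_zero ?_
  have := (R.isUnitalRepresentation i).injective (congrFun (SSpace.glue_injective h0) i)
  exact this.trans ((R.B i).projₗ.map_zero)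

theorem exists_pos_mapₗ_le {ψ : SSpace (Σ i, R.X i)} (hψ : 0 < ψ) :
    ∃ w : E, 0 < w ∧ R.mapₗ w ≤ ψ := by
  obtain ⟨ε, hε, V, hV, ⟨⟨i, p⟩, hp⟩, hVψ⟩ := SSpace.exists_isOpen_lt_repr hψ
  obtain ⟨w, hw, f, hTw, hf, hfV⟩ := (R.isUnitalRepresentation i).exists_pos hε
    (hV.preimage continuous_sigmaMk) ⟨p, hp⟩
  -- Outside `V`, and on the other summands, the image of `w` vanishes, so only positivity of `ψ` is
  -- needed there.
  have hψ0 : ∀ᶠ z in openDenseFilter (Σ i, R.X i), 0 ≤ ψ.repr z := by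
    filter_upwards [SSpace.le_iff_repr.1 hψ.le, SSpace.repr_zero (X := Σ i, R.X i)] with z h h'
    rwa [h'] at h
  refine ⟨w, hw, SSpace.glue_le_iff.2 fun j => ?_⟩
  by_cases hij : j = i
  · subst hij
    rw [Band.proj_coe, hTw]
    filter_upwards [SSpace.repr_mk f.continuous.isDenselyContinuous,
      eventually_openDenseFilter_sigma.1 hψ0 j] with x hx hx0
    rw [SSpace.ofContinuous, hx]
    by_cases hxV : (⟨j, x⟩ : Σ i, R.X i) ∈ V
    · exact (hf x).trans (hVψ _ hxV).le
    · rw [hfV x hxV]; exact hx0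
  · rw [(R.B j).proj_eq_zero fun y hy => R.disjoint i j (Ne.symm hij) w w.2 y hy, map_zero]
    filter_upwards [SSpace.repr_zero (X := R.X j),
      eventually_openDenseFilter_sigma.1 hψ0 j] with x hx hx0
    rw [hx]; exact hx0

theorem isLatticeIdeal_range_mapₗ : IsLatticeIdeal (LinearMap.range R.mapₗ) :=
  R.isLatticeHom_mapₗ.isLatticeIdeal_range R.mapₗ_injective fun _ => R.exists_pos_mapₗ_le

end BandRepresentation

/-! ### Real-valued lattice homomorphisms on the ideal generated by a unit -/

section Unit

variable {E : Type*} [Lattice E] [AddCommGroup E] [IsOrderedAddMonoid E]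
  [Module ℝ E] [IsOrderedModule ℝ E]

theorem self_mem_orderIdeal {u : E} (hu : 0 ≤ u) : u ∈ orderIdeal u :=
  ⟨1, by rw [abs_of_nonneg hu, one_smul]⟩

theorem abs_mem_orderIdeal {u x : E} (hx : x ∈ orderIdeal u) : |x| ∈ orderIdeal u :=
  mem_orderIdeal_of_abs_le hx (abs_abs x).le

theorem sup_mem_orderIdeal {u x y : E} (hx : x ∈ orderIdeal u) (hy : y ∈ orderIdeal u) :
    x ⊔ y ∈ orderIdeal u := by
  refine mem_orderIdeal_of_abs_le (Submodule.add_mem _ (abs_mem_orderIdeal hx)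
    (abs_mem_orderIdeal hy)) ?_
  rw [abs_of_nonneg (add_nonneg (abs_nonneg x) (abs_nonneg y))]
  simpa using abs_sup_sub_sup_le_add x y 0 0

/-- A real-valued unital lattice homomorphism on the ideal generated by `u`, extended by zero. -/
structure IsUnitHom (u : E) (φ : E → ℝ) : Prop where
  map_add : ∀ x ∈ orderIdeal u, ∀ y ∈ orderIdeal u, φ (x + y) = φ x + φ y
  map_smul : ∀ (c : ℝ), ∀ x ∈ orderIdeal u, φ (c • x) = c * φ x
  map_sup : ∀ x ∈ orderIdeal u, ∀ y ∈ orderIdeal u, φ (x ⊔ y) = φ x ⊔ φ y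
  map_unit : φ u = 1
  eq_zero_of_notMem : ∀ x ∉ orderIdeal u, φ x = 0

/-- A maximal one among the ideals that do not contain `u`. -/
structure IsMaximalIdeal (u : E) (I : Submodule ℝ E) : Prop where
  solid : IsLatticeIdeal I
  notMem : u ∉ I
  eq_of_le : ∀ J : Submodule ℝ E, IsLatticeIdeal J → u ∉ J → I ≤ J → J = I

theorem isLatticeIdeal_orderIdeal (u : E) : IsLatticeIdeal (orderIdeal u) :=
  fun _ hx _ h => mem_orderIdeal_of_abs_le hx h

theorem exists_isMaximalIdeal {u : E} {I : Submodule ℝ E} (hI : IsLatticeIdeal I) (hu : u ∉ I) :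
    ∃ M : Submodule ℝ E, I ≤ M ∧ IsMaximalIdeal u M := by
  obtain ⟨M, hIM, hM⟩ := zorn_le_nonempty₀ {J : Submodule ℝ E | IsLatticeIdeal J ∧ u ∉ J}
    (fun c hc hchain J hJ => by
      have hmem : ∀ {x}, x ∈ sSup c ↔ ∃ K ∈ c, x ∈ K :=
        Submodule.mem_sSup_of_directed ⟨J, hJ⟩ hchain.directedOn
      refine ⟨sSup c, ⟨?_, ?_⟩, fun K hK => le_sSup hK⟩
      · intro x hx y h
        obtain ⟨K, hK, hxK⟩ := hmem.1 hx
        exact hmem.2 ⟨K, hK, (hc hK).1 hxK h⟩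
      · intro h
        obtain ⟨K, hK, huK⟩ := hmem.1 h
        exact (hc hK).2 huK) I ⟨hI, hu⟩
  refine ⟨M, hIM, hM.prop.1, hM.prop.2, fun J hJ huJ hle => ?_⟩
  exact le_antisymm (hM.le_of_ge ⟨hJ, huJ⟩ hle) hle

namespace IsMaximalIdeal

variable {u : E} {I : Submodule ℝ E}

/-- Maximal ideals are prime. -/
theorem mem_of_inf_eq_zero (hI : IsMaximalIdeal u I) {a b : E} (ha : 0 ≤ a)
    (hb : 0 ≤ b) (hbu : b ∈ orderIdeal u) (hab : a ⊓ b = 0) (haI : a ∉ I) : b ∈ I := by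
  have habs : ∀ {x}, x ∈ I → |x| ∈ I := fun hx => hI.solid hx (abs_abs _).le
  -- `K` is the ideal generated by `I` and `a`. By maximality it contains `u`, so a multiple of some
  -- `|i| + n • a` dominates `b`; disjointness from `a` removes the second term.
  let K : Submodule ℝ E := solidSubmodule {x | ∃ i ∈ I, ∃ n : ℕ, |x| ≤ |i| + n • a}
    ⟨0, I.zero_mem, 0, by simp⟩
    (fun x ⟨i, hi, n, hn⟩ y ⟨j, hj, m, hm⟩ => ⟨|i| + |j|, I.add_mem (habs hi) (habs hj), n + m, by
      rw [abs_of_nonneg (add_nonneg (abs_nonneg i) (abs_nonneg j)), add_nsmul,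
        add_add_add_comm]
      exact (abs_add_le x y).trans (add_le_add hn hm)⟩)
    (fun x ⟨i, hi, n, hn⟩ y h => ⟨i, hi, n, h.trans hn⟩)
  have hKs : IsLatticeIdeal K := fun x ⟨i, hi, n, hn⟩ y h => ⟨i, hi, n, h.trans hn⟩
  have hIK : I ≤ K := fun x hx => ⟨x, hx, 0, by simp⟩
  have haK : a ∈ K := ⟨0, I.zero_mem, 1, by simp [abs_of_nonneg ha]⟩
  have huK : u ∈ K := by
    by_contra h
    exact haI (hI.eq_of_le K hKs h hIK ▸ haK)
  obtain ⟨i, hi, n, hn⟩ := huK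
  obtain ⟨k, hk⟩ := hbu
  have h1 : b ≤ k • |i| + (k * n) • a := by
    rw [mul_nsmul', ← nsmul_add]
    exact (le_abs_self b).trans (hk.trans
      (nsmul_le_nsmul_right ((le_abs_self u).trans hn) k))
  have h2 : b ≤ k • |i| := calc
    b ≤ b ⊓ (k • |i| + (k * n) • a) := le_inf le_rfl h1
    _ ≤ b ⊓ k • |i| + b ⊓ (k * n) • a :=
      inf_add_le_add_inf hb (nsmul_nonneg (abs_nonneg i) _) (nsmul_nonneg ha _)
    _ = b ⊓ k • |i| := by
      rw [inf_nsmul_eq_zero hb ha (by rw [inf_comm]; exact hab), add_zero]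
    _ ≤ k • |i| := inf_le_right
  refine hI.solid (I.nsmul_mem (habs hi) k) ?_
  rwa [abs_of_nonneg hb, abs_of_nonneg (nsmul_nonneg (abs_nonneg i) k)]

/-- The quotient by `I` has no nonzero infinitesimals relative to `u`: the elements infinitesimal
modulo `I` form an ideal containing `I` but not `u` (take `ε = 1 / 2`), which by maximality is `I`.
-/
theorem mem_of_forall_posPart_mem (hI : IsMaximalIdeal u I) (hu : 0 ≤ u) {x : E}
    (h : ∀ ε : ℝ, 0 < ε → (|x| - ε • u)⁺ ∈ I) : x ∈ I := by
  have hle : ∀ {a b : E}, 0 ≤ a → a ≤ b → b ∈ I → a ∈ I := fun ha hab hb =>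
    hI.solid hb (by rwa [abs_of_nonneg ha, abs_of_nonneg (ha.trans hab)])
  have hsolid : ∀ x ∈ {x : E | ∀ ε : ℝ, 0 < ε → (|x| - ε • u)⁺ ∈ I}, ∀ y, |y| ≤ |x| →
      y ∈ {x : E | ∀ ε : ℝ, 0 < ε → (|x| - ε • u)⁺ ∈ I} := fun x hx y hy ε hε =>
    hle (posPart_nonneg _) (posPart_mono (sub_le_sub_right hy _)) (hx ε hε)
  let J : Submodule ℝ E := solidSubmodule {x : E | ∀ ε : ℝ, 0 < ε → (|x| - ε • u)⁺ ∈ I}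
    (fun ε hε => by
      rw [abs_zero, zero_sub, posPart_eq_zero.2 (neg_nonpos.2 (smul_nonneg hε.le hu))]
      exact I.zero_mem)
    (fun x hx y hy ε hε => by
      refine hle (posPart_nonneg _) ?_ (I.add_mem (hx _ (half_pos hε)) (hy _ (half_pos hε)))
      refine sup_le ?_ (add_nonneg (posPart_nonneg _) (posPart_nonneg _))
      calc |x + y| - ε • u ≤ (|x| + |y|) - ε • u := sub_le_sub_right (abs_add_le x y) _
        _ = (|x| - (ε / 2) • u) + (|y| - (ε / 2) • u) := by
          rw [sub_add_sub_comm, ← add_smul, add_halves]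
        _ ≤ _ := add_le_add (le_posPart _) (le_posPart _)) hsolid
  have hIJ : I ≤ J := fun x hx ε hε => by
    refine hle (posPart_nonneg _) (sup_le (sub_le_self _ (smul_nonneg hε.le hu)) (abs_nonneg x))
      (hI.solid hx (abs_abs x).le)
  have huJ : u ∉ J := fun h => by
    have h1 := h (1 / 2) (by norm_num)
    have h2 : |u| - (1 / 2 : ℝ) • u = (1 / 2 : ℝ) • u := by
      rw [abs_of_nonneg hu, sub_eq_iff_eq_add, ← add_smul]; norm_num
    rw [h2, posPart_eq_self.2 (smul_nonneg (by norm_num) hu)] at h1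
    have := I.smul_mem (2 : ℝ) h1
    rw [smul_smul] at this
    norm_num at this
    exact hI.notMem this
  have hx : x ∈ J := h
  rwa [hI.eq_of_le J (fun x hx y => hsolid x hx y) huJ hIJ] at hx

/-- Modulo `I` the unit ideal is one-dimensional. The number `t` is a Dedekind cut, the infimum of
those `s` for which `x ≤ s • u` modulo `I`; primality makes `x - t • u` infinitesimal modulo `I`. -/
theorem exists_sub_smul_mem (hI : IsMaximalIdeal u I) (hu : 0 ≤ u) {x : E}
    (hx : x ∈ orderIdeal u) : ∃ t : ℝ, x - t • u ∈ I := by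
  have hle : ∀ {a b : E}, 0 ≤ a → a ≤ b → b ∈ I → a ∈ I := fun ha hab hb =>
    hI.solid hb (by rwa [abs_of_nonneg ha, abs_of_nonneg (ha.trans hab)])
  obtain ⟨n, hn⟩ := id hx
  have hn1 : x ≤ (n : ℝ) • u := by
    rw [Nat.cast_smul_eq_nsmul]; exact (le_abs_self x).trans hn
  have hn2 : -((n : ℝ) • u) ≤ x := by
    rw [Nat.cast_smul_eq_nsmul]; exact neg_le.1 ((neg_le_abs x).trans hn)
  set S : Set ℝ := {t | (x - t • u)⁺ ∈ I}
  have hne : S.Nonempty := ⟨n, by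
    change (x - (n : ℝ) • u)⁺ ∈ I
    rw [posPart_eq_zero.2 (sub_nonpos.2 hn1)]; exact I.zero_mem⟩
  have hmono : ∀ s ∈ S, ∀ t, s ≤ t → t ∈ S := fun s hs t hst =>
    hle (posPart_nonneg _) (posPart_mono (sub_le_sub_left (smul_le_smul_of_nonneg_right hst hu) _))
      hs
  have hbdd : BddBelow S := ⟨-n, fun t ht => by
    by_contra! hlt
    have h1 : (-n - t : ℝ) • u ∈ I := by
      refine hle (smul_nonneg (by linarith) hu) ?_ ht
      refine le_trans ?_ (le_posPart _)
      rw [sub_smul, neg_smul]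
      exact sub_le_sub_right hn2 _
    have h2 := I.smul_mem (-n - t : ℝ)⁻¹ h1
    rw [smul_smul, inv_mul_cancel₀ (by linarith), one_smul] at h2
    exact hI.notMem h2⟩
  refine ⟨sInf S, hI.mem_of_forall_posPart_mem hu fun ε hε => ?_⟩
  set t := sInf S
  have h1 : (x - (t + ε) • u)⁺ ∈ I := by
    obtain ⟨s, hs, hst⟩ := exists_lt_of_csInf_lt hne (show sInf S < t + ε by linarith)
    exact hmono s hs _ hst.le
  -- Below the infimum the positive part is not in `I`, so the negative part, being disjoint from
  -- it, is.
  have h2 : (x - (t - ε) • u)⁻ ∈ I := by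
    refine hI.mem_of_inf_eq_zero (posPart_nonneg (x - (t - ε) • u)) (negPart_nonneg _) ?_
      (posPart_inf_negPart_eq_zero _) fun h => ?_
    · refine mem_orderIdeal_of_abs_le (Submodule.sub_mem _ hx
        (Submodule.smul_mem _ (t - ε) (self_mem_orderIdeal hu))) ?_
      rw [abs_of_nonneg (negPart_nonneg _)]
      exact sup_le (neg_le_abs _) (abs_nonneg _)
    · linarith [csInf_le hbdd h]
  refine hle (posPart_nonneg _) ?_ (I.add_mem h1 h2)
  refine sup_le ?_ (add_nonneg (posPart_nonneg _) (negPart_nonneg _))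
  rw [sub_le_iff_le_add]
  refine abs_le'.2 ⟨?_, ?_⟩
  · rw [← sub_le_iff_le_add, sub_sub, ← add_smul]
    exact (le_posPart _).trans (le_add_of_nonneg_right (negPart_nonneg _))
  · rw [← sub_le_iff_le_add]
    have : -(x - t • u) - ε • u = -(x - (t - ε) • u) := by rw [sub_smul]; abel
    rw [this]
    exact (neg_le_negPart _).trans (le_add_of_nonneg_left (posPart_nonneg _))

theorem eq_of_sub_smul_mem (hI : IsMaximalIdeal u I) {x : E} {s t : ℝ} (hs : x - s • u ∈ I)
    (ht : x - t • u ∈ I) : s = t := by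
  by_contra hne
  have h := I.sub_mem ht hs
  rw [sub_sub_sub_cancel_left, ← sub_smul] at h
  have h2 := I.smul_mem (s - t)⁻¹ h
  rw [smul_smul, inv_mul_cancel₀ (sub_ne_zero.2 hne), one_smul] at h2
  exact hI.notMem h2

-- The coefficient of `u` modulo `I` is unique, so each homomorphism identity only requires
-- exhibiting one valid coefficient.
open Classical in
theorem exists_isUnitHom (hI : IsMaximalIdeal u I) (hu : 0 ≤ u) :
    ∃ φ : E → ℝ, IsUnitHom u φ ∧ ∀ x ∈ orderIdeal u, x - φ x • u ∈ I := by
  choose! t ht using fun x (hx : x ∈ orderIdeal u) => hI.exists_sub_smul_mem hu hx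
  set φ : E → ℝ := fun x => if x ∈ orderIdeal u then t x else 0 with hφ
  have hmem : ∀ x ∈ orderIdeal u, x - φ x • u ∈ I := fun x hx => by
    simp only [hφ, if_pos hx]; exact ht x hx
  refine ⟨φ, ⟨fun x hx y hy => ?_, fun c x hx => ?_, fun x hx y hy => ?_, ?_, fun x hx => ?_⟩, hmem⟩
  · refine hI.eq_of_sub_smul_mem (hmem _ (Submodule.add_mem _ hx hy)) ?_
    rw [add_smul, add_sub_add_comm]
    exact I.add_mem (hmem x hx) (hmem y hy)
  · refine hI.eq_of_sub_smul_mem (hmem _ (Submodule.smul_mem _ c hx)) ?_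
    rw [mul_smul, ← smul_sub]
    exact I.smul_mem c (hmem x hx)
  · refine hI.eq_of_sub_smul_mem (hmem _ (sup_mem_orderIdeal hx hy)) ?_
    have habs : ∀ {x}, x ∈ I → |x| ∈ I := fun hx => hI.solid hx (abs_abs _).le
    refine hI.solid (I.add_mem (habs (hmem x hx)) (habs (hmem y hy))) ?_
    rw [abs_of_nonneg (add_nonneg (abs_nonneg (x - φ x • u)) (abs_nonneg _))]
    have hsup : (φ x ⊔ φ y) • u = φ x • u ⊔ φ y • u :=
      Monotone.map_sup (f := fun c : ℝ => c • u)
        (fun _ _ h => smul_le_smul_of_nonneg_right h hu) _ _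
    rw [hsup]
    exact abs_sup_sub_sup_le_add _ _ _ _
  · exact hI.eq_of_sub_smul_mem (hmem _ (self_mem_orderIdeal hu)) (by simp)
  · simp only [hφ, if_neg hx]

end IsMaximalIdeal

namespace IsUnitHom

variable {u : E} {φ : E → ℝ}

theorem map_zero (hφ : IsUnitHom u φ) : φ 0 = 0 := by
  simpa using hφ.map_smul 0 0 (Submodule.zero_mem _)

theorem map_neg (hφ : IsUnitHom u φ) {x : E} (hx : x ∈ orderIdeal u) : φ (-x) = -φ x := by
  simpa using hφ.map_smul (-1) x hx

theorem map_sub (hφ : IsUnitHom u φ) {x y : E} (hx : x ∈ orderIdeal u) (hy : y ∈ orderIdeal u) :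
    φ (x - y) = φ x - φ y := by
  rw [sub_eq_add_neg, hφ.map_add x hx _ (Submodule.neg_mem _ hy), hφ.map_neg hy, sub_eq_add_neg]

theorem mono (hφ : IsUnitHom u φ) {x y : E} (hx : x ∈ orderIdeal u) (hy : y ∈ orderIdeal u)
    (h : x ≤ y) : φ x ≤ φ y := by
  rw [← sup_eq_right, ← hφ.map_sup x hx y hy, sup_eq_right.2 h]

theorem nonneg (hφ : IsUnitHom u φ) {x : E} (hx : x ∈ orderIdeal u) (h : 0 ≤ x) : 0 ≤ φ x := by
  rw [← hφ.map_zero]; exact hφ.mono (Submodule.zero_mem _) hx h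

theorem map_abs (hφ : IsUnitHom u φ) {x : E} (hx : x ∈ orderIdeal u) : φ |x| = |φ x| := by
  rw [abs, hφ.map_sup x hx _ (Submodule.neg_mem _ hx), hφ.map_neg hx]; rfl

theorem map_inf (hφ : IsUnitHom u φ) {x y : E} (hx : x ∈ orderIdeal u) (hy : y ∈ orderIdeal u)
    : φ (x ⊓ y) = φ x ⊓ φ y := by
  have h : x ⊓ y = -(-x ⊔ -y) := by rw [neg_sup, neg_neg, neg_neg]
  rw [h, hφ.map_neg (sup_mem_orderIdeal (Submodule.neg_mem _ hx) (Submodule.neg_mem _ hy)),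
    hφ.map_sup _ (Submodule.neg_mem _ hx) _ (Submodule.neg_mem _ hy), hφ.map_neg hx,
    hφ.map_neg hy, neg_sup, neg_neg, neg_neg]

end IsUnitHom

/-- In an Archimedean vector lattice the unital lattice homomorphisms separate the points of the
ideal generated by a weak unit. -/
theorem IsWeakUnit.exists_isUnitHom_pos {u : E} (hu : IsWeakUnit u)
    (harch : ∀ x y : E, (∀ n : ℕ, n • x ≤ y) → x ≤ 0) {w : E} (hw : w ∈ orderIdeal u)
    (hpos : ¬ w ≤ 0) : ∃ φ : E → ℝ, IsUnitHom u φ ∧ 0 < φ w := by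
  have hu0 := hu.pos.le
  have huu := self_mem_orderIdeal hu0
  obtain ⟨ε, hε, hne⟩ : ∃ ε : ℝ, 0 < ε ∧ (w - ε • u)⁺ ≠ 0 := by
    by_contra! h
    refine hpos (harch w u fun n => ?_)
    rcases Nat.eq_zero_or_pos n with rfl | hn
    · simpa using hu0
    · have hn' : (0 : ℝ) < n := Nat.cast_pos.2 hn
      have h1 := sub_nonpos.1 (posPart_eq_zero.1 (h (n : ℝ)⁻¹ (inv_pos.2 hn')))
      have h2 := smul_le_smul_of_nonneg_left h1 hn'.le
      rwa [smul_smul, mul_inv_cancel₀ hn'.ne', one_smul, Nat.cast_smul_eq_nsmul] at h2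
  set b := (w - ε • u)⁻ with hb
  have hb0 : 0 ≤ b := negPart_nonneg _
  -- If a multiple of `b` dominated `u`, then `(w - ε • u)⁺`, being disjoint from `b`, would be
  -- disjoint from the weak unit. A maximal ideal containing `b` then gives `φ b = 0`, that is `φ w
  -- ≥ ε`.
  have hub : u ∉ orderIdeal b := by
    rintro ⟨n, hn⟩
    refine hne (hu.eq_zero_of_disjoint _ ?_)
    rw [abs_of_nonneg (posPart_nonneg _)]
    refine le_antisymm ?_ (le_inf (posPart_nonneg _) hu0)
    rw [← inf_nsmul_eq_zero (posPart_nonneg _) hb0 (posPart_inf_negPart_eq_zero _) n]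
    exact inf_le_inf_left _ ((le_abs_self u).trans hn)
  obtain ⟨I, hbI, hI⟩ := exists_isMaximalIdeal (isLatticeIdeal_orderIdeal b) hub
  obtain ⟨φ, hφ, hφI⟩ := hI.exists_isUnitHom hu0
  refine ⟨φ, hφ, ?_⟩
  have hwe : w - ε • u ∈ orderIdeal u := Submodule.sub_mem _ hw (Submodule.smul_mem _ _ huu)
  have hbu : b ∈ orderIdeal u := by
    rw [hb, negPart_def]
    exact sup_mem_orderIdeal (Submodule.neg_mem _ hwe) (Submodule.zero_mem _)
  have hφb : φ b = 0 := hI.eq_of_sub_smul_mem (hφI b hbu)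
    (by simpa using hbI (self_mem_orderIdeal hb0))
  have h1 : φ b = -(φ w - ε) ⊔ 0 := by
    rw [hb, negPart_def, hφ.map_sup _ (Submodule.neg_mem _ hwe) _ (Submodule.zero_mem _),
      hφ.map_neg hwe, hφ.map_sub hw (Submodule.smul_mem _ _ huu), hφ.map_smul _ _ huu,
      hφ.map_unit, mul_one, hφ.map_zero]
  have h2 : -(φ w - ε) ≤ 0 := by rw [← hφb, h1]; exact le_sup_left
  linarith

theorem IsWeakUnit.le_of_forall_isUnitHom {u : E} (hu : IsWeakUnit u)
    (harch : ∀ x y : E, (∀ n : ℕ, n • x ≤ y) → x ≤ 0) {x y : E} (hx : x ∈ orderIdeal u)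
    (hy : y ∈ orderIdeal u) (h : ∀ φ, IsUnitHom u φ → φ x ≤ φ y) : x ≤ y := by
  by_contra hle
  obtain ⟨φ, hφ, hpos⟩ := hu.exists_isUnitHom_pos harch (Submodule.sub_mem _ hx hy)
    (fun h => hle (sub_nonpos.1 h))
  rw [hφ.map_sub hx hy] at hpos
  linarith [h φ hφ]

end Unit

/-! ### The representation of an Archimedean vector lattice with a weak unit -/

section Representation

variable {E : Type*} [Lattice E] [AddCommGroup E] [IsOrderedAddMonoid E]
  [Module ℝ E] [IsOrderedModule ℝ E]

theorem inf_mem_orderIdeal {u x : E} (hu : 0 ≤ u) (hx : 0 ≤ x) : x ⊓ u ∈ orderIdeal u :=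
  ⟨1, by rw [abs_of_nonneg (le_inf hx hu), one_smul]; exact inf_le_right⟩

/-- The compact space of unital lattice homomorphisms on the ideal generated by `u`. -/
def UnitHoms (u : E) : Type _ := {φ : E → ℝ // IsUnitHom u φ}

namespace UnitHoms

variable {u : E}

instance : CoeFun (UnitHoms u) (fun _ => E → ℝ) := ⟨Subtype.val⟩

instance : TopologicalSpace (UnitHoms u) := inferInstanceAs (TopologicalSpace (Subtype _))

instance : T2Space (UnitHoms u) := inferInstanceAs (T2Space (Subtype _))

theorem continuous_apply (x : E) : Continuous fun φ : UnitHoms u => φ x :=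
  (_root_.continuous_apply x).comp continuous_subtype_val

theorem isClosed_setOf_isUnitHom (u : E) : IsClosed {φ : E → ℝ | IsUnitHom u φ} := by
  have h : {φ : E → ℝ | IsUnitHom u φ} =
      {φ | ∀ x ∈ orderIdeal u, ∀ y ∈ orderIdeal u, φ (x + y) = φ x + φ y} ∩
      {φ | ∀ (c : ℝ), ∀ x ∈ orderIdeal u, φ (c • x) = c * φ x} ∩
      {φ | ∀ x ∈ orderIdeal u, ∀ y ∈ orderIdeal u, φ (x ⊔ y) = φ x ⊔ φ y} ∩
      {φ | φ u = 1} ∩ {φ | ∀ x ∉ orderIdeal u, φ x = 0} := by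
    ext φ
    exact ⟨fun h => ⟨⟨⟨⟨h.1, h.2⟩, h.3⟩, h.4⟩, h.5⟩,
      fun h => ⟨h.1.1.1.1, h.1.1.1.2, h.1.1.2, h.1.2, h.2⟩⟩
  rw [h]
  simp only [Set.ofPred_forall]
  refine (((IsClosed.inter ?_ ?_).inter ?_).inter ?_).inter ?_
  · exact isClosed_iInter fun x => isClosed_iInter fun _ => isClosed_iInter fun y =>
      isClosed_iInter fun _ => isClosed_eq (by fun_prop) (by fun_prop)
  · exact isClosed_iInter fun c => isClosed_iInter fun x => isClosed_iInter fun _ =>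
      isClosed_eq (by fun_prop) (by fun_prop)
  · exact isClosed_iInter fun x => isClosed_iInter fun _ => isClosed_iInter fun y =>
      isClosed_iInter fun _ => isClosed_eq (by fun_prop) (by fun_prop)
  · exact isClosed_eq (by fun_prop) (by fun_prop)
  · exact isClosed_iInter fun x => isClosed_iInter fun _ =>
      isClosed_eq (by fun_prop) (by fun_prop)

/-- Tychonoff: `|x| ≤ n • u` forces `|φ x| ≤ n`, and outside the ideal `φ` is fixed at `0`, so this
is a closed subset of a product of compact intervals. -/
theorem isCompact_setOf_isUnitHom (hu : 0 ≤ u) : IsCompact {φ : E → ℝ | IsUnitHom u φ} := by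
  have hb : ∀ x : E, ∃ k : ℝ, ∀ φ, IsUnitHom u φ → φ x ∈ Set.Icc (-k) k := by
    intro x
    by_cases hx : x ∈ orderIdeal u
    · obtain ⟨n, hn⟩ := id hx
      refine ⟨n, fun φ hφ => abs_le.1 ?_⟩
      have huu := self_mem_orderIdeal hu
      rw [← hφ.map_abs hx]
      have := hφ.mono (abs_mem_orderIdeal hx) (Submodule.smul_mem _ (n : ℝ) huu)
        (by rwa [Nat.cast_smul_eq_nsmul])
      rwa [hφ.map_smul _ _ huu, hφ.map_unit, mul_one] at this
    · exact ⟨0, fun φ hφ => by rw [hφ.eq_zero_of_notMem x hx]; simp⟩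
  choose k hk using hb
  exact (isCompact_univ_pi fun x => isCompact_Icc (a := -k x) (b := k x)).of_isClosed_subset
    (isClosed_setOf_isUnitHom u) fun φ hφ x _ => hk x φ hφ

/-- The function on the space of homomorphisms given by evaluation at `x`. -/
def eval (x : E) : C(UnitHoms u, ℝ) := ⟨fun φ => φ x, continuous_apply x⟩

theorem dense_range_eval [CompactSpace (UnitHoms u)] (hu : 0 ≤ u) :
    Dense (eval (u := u) '' (orderIdeal u : Set E)) := by
  have huu := self_mem_orderIdeal hu
  refine dense_iff_closure_eq.2 (ContinuousMap.sublattice_closure_eq_top _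
    ⟨_, 0, Submodule.zero_mem _, rfl⟩ ?_ ?_ ?_)
  · rintro _ ⟨x, hx, rfl⟩ _ ⟨y, hy, rfl⟩
    refine ⟨x ⊓ y, ?_, ContinuousMap.ext fun φ => φ.2.map_inf hx hy⟩
    refine mem_orderIdeal_of_abs_le (Submodule.add_mem _ (abs_mem_orderIdeal hx)
      (abs_mem_orderIdeal hy)) ?_
    rw [abs_of_nonneg (add_nonneg (abs_nonneg x) (abs_nonneg y))]
    simpa using abs_inf_sub_inf_le_add x y 0 0
  · rintro _ ⟨x, hx, rfl⟩ _ ⟨y, hy, rfl⟩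
    exact ⟨x ⊔ y, sup_mem_orderIdeal hx hy, ContinuousMap.ext fun φ => φ.2.map_sup x hx y hy⟩
  · intro v φ ψ
    by_cases hφψ : φ = ψ
    · subst hφψ
      refine ⟨_, ⟨v φ • u, Submodule.smul_mem _ _ huu, rfl⟩, ?_, ?_⟩ <;>
      · change φ (v φ • u) = v φ
        rw [φ.2.map_smul _ _ huu, φ.2.map_unit, mul_one]
    · obtain ⟨x, hne⟩ : ∃ x, φ x ≠ ψ x := by
        by_contra! h
        exact hφψ (Subtype.ext (funext h))
      -- Outside the ideal all homomorphisms share the default value `0`.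
      have hx : x ∈ orderIdeal u := by
        by_contra hx
        exact hne (by rw [φ.2.eq_zero_of_notMem x hx, ψ.2.eq_zero_of_notMem x hx])
      -- Two-point interpolation: the combination of `x` and `u` agreeing with `v` at `φ` and `ψ`.
      set c := (v φ - v ψ) / (φ x - ψ x) with hc
      have hcx : c * (φ x - ψ x) = v φ - v ψ := div_mul_cancel₀ _ (sub_ne_zero.2 hne)
      have key : ∀ χ : UnitHoms u, χ (c • x + (v φ - c * φ x) • u) = c * χ x + (v φ - c * φ x) :=
        fun χ => by
          rw [χ.2.map_add _ (Submodule.smul_mem _ _ hx) _ (Submodule.smul_mem _ _ huu),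
            χ.2.map_smul _ _ hx, χ.2.map_smul _ _ huu, χ.2.map_unit, mul_one]
      refine ⟨_, ⟨c • x + (v φ - c * φ x) • u, Submodule.add_mem _ (Submodule.smul_mem _ _ hx)
        (Submodule.smul_mem _ _ huu), rfl⟩, ?_, ?_⟩
      · exact (key φ).trans (by ring)
      · exact (key ψ).trans (by linarith)

end UnitHoms

/-! ### Values of arbitrary elements at a homomorphism -/

/-- The elements of `E` that vanish at `φ`. -/
def IsUnitHom.nullIdeal {u : E} {φ : E → ℝ} (hφ : IsUnitHom u φ) (hu : 0 ≤ u) : Submodule ℝ E :=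
  have hmono : ∀ {a b : E}, 0 ≤ a → a ≤ b → φ (b ⊓ u) = 0 → φ (a ⊓ u) = 0 :=
    fun ha hab hb => le_antisymm ((hφ.mono (inf_mem_orderIdeal hu ha)
      (inf_mem_orderIdeal hu (ha.trans hab)) (inf_le_inf_right u hab)).trans hb.le)
      (hφ.nonneg (inf_mem_orderIdeal hu ha) (le_inf ha hu))
  solidSubmodule {x | φ (|x| ⊓ u) = 0}
    (by
      change φ (|0| ⊓ u) = 0
      rw [abs_zero, inf_of_le_left hu, hφ.map_zero])
    (fun x hx y hy => by
      refine hmono (abs_nonneg _) (abs_add_le x y) (le_antisymm ?_ (hφ.nonneg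
        (inf_mem_orderIdeal hu (add_nonneg (abs_nonneg x) (abs_nonneg y)))
        (le_inf (add_nonneg (abs_nonneg x) (abs_nonneg y)) hu)))
      have hx' := inf_mem_orderIdeal hu (abs_nonneg x)
      have hy' := inf_mem_orderIdeal hu (abs_nonneg y)
      refine (hφ.mono (inf_mem_orderIdeal hu (add_nonneg (abs_nonneg x) (abs_nonneg y)))
        (Submodule.add_mem _ hx' hy') ?_).trans (by
          rw [hφ.map_add _ hx' _ hy', show φ (|x| ⊓ u) = 0 from hx, show φ (|y| ⊓ u) = 0 from hy,
            add_zero])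
      rw [inf_comm, inf_comm |x|, inf_comm |y|]
      exact inf_add_le_add_inf hu (abs_nonneg x) (abs_nonneg y))
    (fun x hx y h => hmono (abs_nonneg y) h hx)

/-- The element `x` takes the value `t` at the homomorphism `φ`. -/
def HasValue (u : E) (φ : E → ℝ) (x : E) (t : ℝ) : Prop := φ (|x - t • u| ⊓ u) = 0

namespace IsUnitHom

variable {u : E} {φ : E → ℝ}

theorem mem_nullIdeal (hφ : IsUnitHom u φ) (hu : 0 ≤ u) {x : E} :
    x ∈ hφ.nullIdeal hu ↔ φ (|x| ⊓ u) = 0 := Iff.rfl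

theorem hasValue_iff (hφ : IsUnitHom u φ) (hu : 0 ≤ u) {x : E} {t : ℝ} :
    HasValue u φ x t ↔ x - t • u ∈ hφ.nullIdeal hu := Iff.rfl

theorem mem_nullIdeal_of_abs_le (hφ : IsUnitHom u φ) (hu : 0 ≤ u) {x y : E}
    (hx : x ∈ hφ.nullIdeal hu) (h : |y| ≤ |x|) : y ∈ hφ.nullIdeal hu := by
  rw [hφ.mem_nullIdeal hu] at hx ⊢
  exact le_antisymm ((hφ.mono (inf_mem_orderIdeal hu (abs_nonneg y))
    (inf_mem_orderIdeal hu (abs_nonneg x)) (inf_le_inf_right u h)).trans hx.le)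
    (hφ.nonneg (inf_mem_orderIdeal hu (abs_nonneg y)) (le_inf (abs_nonneg y) hu))

theorem hasValue_of_mem (hφ : IsUnitHom u φ) (hu : 0 ≤ u) {x : E} (hx : x ∈ orderIdeal u) :
    HasValue u φ x (φ x) := by
  have huu := self_mem_orderIdeal hu
  have hsub : x - φ x • u ∈ orderIdeal u := Submodule.sub_mem _ hx (Submodule.smul_mem _ _ huu)
  rw [HasValue, hφ.map_inf (abs_mem_orderIdeal hsub) huu, hφ.map_abs hsub,
    hφ.map_sub hx (Submodule.smul_mem _ _ huu), hφ.map_smul _ _ huu, hφ.map_unit]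
  simp

theorem hasValue_unique (hφ : IsUnitHom u φ) (hu : 0 ≤ u) {x : E} {s t : ℝ}
    (hs : HasValue u φ x s) (ht : HasValue u φ x t) : s = t := by
  by_contra hne
  have h := (hφ.nullIdeal hu).sub_mem ((hφ.hasValue_iff hu).1 ht) ((hφ.hasValue_iff hu).1 hs)
  rw [sub_sub_sub_cancel_left, ← sub_smul] at h
  have h2 := (hφ.nullIdeal hu).smul_mem (s - t)⁻¹ h
  rw [smul_smul, inv_mul_cancel₀ (sub_ne_zero.2 hne), one_smul, hφ.mem_nullIdeal,
    abs_of_nonneg hu, inf_idem, hφ.map_unit] at h2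
  exact one_ne_zero h2

theorem hasValue_add (hφ : IsUnitHom u φ) (hu : 0 ≤ u) {x y : E} {s t : ℝ}
    (hs : HasValue u φ x s) (ht : HasValue u φ y t) : HasValue u φ (x + y) (s + t) := by
  have := (hφ.nullIdeal hu).add_mem ((hφ.hasValue_iff hu).1 hs) ((hφ.hasValue_iff hu).1 ht)
  rwa [← add_sub_add_comm, ← add_smul] at this

theorem hasValue_smul (hφ : IsUnitHom u φ) (hu : 0 ≤ u) {x : E} {t : ℝ} (c : ℝ)
    (ht : HasValue u φ x t) : HasValue u φ (c • x) (c * t) := by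
  have := (hφ.nullIdeal hu).smul_mem c ((hφ.hasValue_iff hu).1 ht)
  rwa [smul_sub, smul_smul] at this

theorem hasValue_sup (hφ : IsUnitHom u φ) (hu : 0 ≤ u) {x y : E} {s t : ℝ}
    (hs : HasValue u φ x s) (ht : HasValue u φ y t) : HasValue u φ (x ⊔ y) (s ⊔ t) := by
  have habs : ∀ {x}, x ∈ hφ.nullIdeal hu → |x| ∈ hφ.nullIdeal hu := fun hx =>
    hφ.mem_nullIdeal_of_abs_le hu hx (abs_abs _).le
  refine (hφ.hasValue_iff hu).2 (hφ.mem_nullIdeal_of_abs_le hu ((hφ.nullIdeal hu).add_mem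
    (habs ((hφ.hasValue_iff hu).1 hs)) (habs ((hφ.hasValue_iff hu).1 ht))) ?_)
  have hsup : (s ⊔ t) • u = s • u ⊔ t • u :=
    Monotone.map_sup (f := fun c : ℝ => c • u)
      (fun _ _ h => smul_le_smul_of_nonneg_right h hu) _ _
  rw [abs_of_nonneg (add_nonneg (abs_nonneg (x - s • u)) (abs_nonneg _)), hsup]
  exact abs_sup_sub_sup_le_add _ _ _ _

/-- The truncation of `y` to `[-u, u]` differs from `y` by at most `c = (|y| - u)⁺`. This `c` is
disjoint from `u - |y| ⊓ u`, whose value at `φ` is positive, so `c` vanishes at `φ`. -/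
theorem hasValue_of_lt (hφ : IsUnitHom u φ) (hu : 0 ≤ u) {y : E} (h : φ (|y| ⊓ u) < 1) :
    HasValue u φ y (φ ((y ⊓ u) ⊔ -u)) := by
  have huu := self_mem_orderIdeal hu
  set z := (y ⊓ u) ⊔ -u with hz
  have hzu : z ∈ orderIdeal u := ⟨1, by
    rw [one_smul]
    exact abs_le'.2 ⟨sup_le inf_le_right (neg_le_self hu), neg_le.1 le_sup_right⟩⟩
  set c := (|y| - u)⁺ with hc
  have hc0 : 0 ≤ c := posPart_nonneg _
  have hyz : |y - z| ≤ |c| := by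
    rw [abs_of_nonneg hc0]
    refine abs_le'.2 ⟨?_, ?_⟩
    · have h1 : y - c ≤ z := by
        refine le_trans (le_inf (sub_le_self _ hc0) ?_) le_sup_left
        rw [sub_le_comm]
        exact (sub_le_sub_right (le_abs_self y) u).trans (le_posPart _)
      exact sub_le_comm.1 h1
    · rw [neg_sub, sub_le_iff_le_add]
      refine sup_le (inf_le_left.trans (le_add_of_nonneg_left hc0)) ?_
      rw [← sub_le_iff_le_add, sub_eq_add_neg, add_comm, ← sub_eq_add_neg]
      exact (sub_le_sub_right (neg_le_abs y) u).trans (le_posPart _)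
  have hcN : c ∈ hφ.nullIdeal hu := by
    rw [hφ.mem_nullIdeal hu, abs_of_nonneg hc0]
    have hd : (|y| - u)⁻ = u - |y| ⊓ u := by
      rw [negPart_def, neg_sub, sub_inf, sub_self]
    have hyu := inf_mem_orderIdeal hu (abs_nonneg y)
    have hcu := inf_mem_orderIdeal hu hc0
    have h0 : (c ⊓ u) ⊓ (u - |y| ⊓ u) = 0 := by
      rw [← hd]
      refine le_antisymm ?_ (le_inf (le_inf hc0 hu) (negPart_nonneg _))
      rw [← posPart_inf_negPart_eq_zero (|y| - u)]
      exact inf_le_inf_right _ inf_le_left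
    have h1 := congrArg φ h0
    rw [hφ.map_inf hcu (Submodule.sub_mem _ huu hyu), hφ.map_sub huu hyu, hφ.map_unit,
      hφ.map_zero] at h1
    rcases le_total (φ (c ⊓ u)) (1 - φ (|y| ⊓ u)) with h2 | h2
    · rwa [inf_of_le_left h2] at h1
    · rw [inf_of_le_right h2] at h1
      linarith
  have := (hφ.nullIdeal hu).add_mem (hφ.mem_nullIdeal_of_abs_le hu hcN hyz)
    ((hφ.hasValue_iff hu).1 (hφ.hasValue_of_mem hu hzu))
  rwa [sub_add_sub_cancel] at this

end IsUnitHom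

namespace UnitHoms

variable {u : E}

open Classical in
/-- The value of `x` at a homomorphism, with the default `0`. -/
def value (x : E) (φ : UnitHoms u) : ℝ := if h : ∃ t, HasValue u φ x t then h.choose else 0

theorem value_eq (hu : 0 ≤ u) {φ : UnitHoms u} {x : E} {t : ℝ} (h : HasValue u φ x t) :
    value x φ = t := by
  have hex : ∃ t, HasValue u φ x t := ⟨t, h⟩
  rw [value, dif_pos hex]
  exact φ.2.hasValue_unique hu hex.choose_spec h

/-- The truncation criterion applied to `x - t • u` is an open condition on `ψ`, and the value it
yields is evaluation at an element of the ideal plus a constant. Openness of the domain and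
continuity of the value both follow. -/
theorem exists_isOpen_hasValue (hu : 0 ≤ u) {x : E} {φ : UnitHoms u} {t : ℝ}
    (h : HasValue u φ x t) : ∃ V : Set (UnitHoms u), IsOpen V ∧ φ ∈ V ∧
      ∀ ψ ∈ V, HasValue u ψ x (ψ (((x - t • u) ⊓ u) ⊔ -u) + t) := by
  refine ⟨{ψ | ψ (|x - t • u| ⊓ u) < 1}, isOpen_lt (continuous_apply _) continuous_const, ?_,
    fun ψ hψ => ?_⟩
  · change φ (|x - t • u| ⊓ u) < 1
    rw [show φ (|x - t • u| ⊓ u) = 0 from h]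
    exact zero_lt_one
  · have := ψ.2.hasValue_add hu (ψ.2.hasValue_of_lt hu hψ)
      (ψ.2.hasValue_smul hu t (ψ.2.hasValue_of_mem hu (self_mem_orderIdeal hu)))
    rwa [sub_add_cancel, ψ.2.map_unit, mul_one] at this

theorem isOpen_setOf_hasValue (hu : 0 ≤ u) (x : E) :
    IsOpen {φ : UnitHoms u | ∃ t, HasValue u φ x t} := by
  refine isOpen_iff_forall_mem_open.2 fun φ ⟨t, ht⟩ => ?_
  obtain ⟨V, hV, hφV, hval⟩ := exists_isOpen_hasValue hu ht
  exact ⟨V, fun ψ hψ => ⟨_, hval ψ hψ⟩, hV, hφV⟩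

theorem continuousOn_value (hu : 0 ≤ u) (x : E) :
    ContinuousOn (value x) {φ : UnitHoms u | ∃ t, HasValue u φ x t} := by
  rintro φ ⟨t, ht⟩
  obtain ⟨V, hV, hφV, hval⟩ := exists_isOpen_hasValue hu ht
  refine ContinuousAt.continuousWithinAt ?_
  refine ((continuous_apply (((x - t • u) ⊓ u) ⊔ -u)).add
    continuous_const).continuousAt.congr (f := fun ψ => ψ (((x - t • u) ⊓ u) ⊔ -u) + t) ?_
  filter_upwards [hV.mem_nhds hφV] with ψ hψ
  exact (value_eq hu (hval ψ hψ)).symm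

/-- If `x` had no value anywhere on a nonempty open `V`, it would be infinite there: a bump `w`
supported in `V` would satisfy `n • w ≤ |x|` for all `n`, against the Archimedean property. -/
theorem dense_setOf_hasValue [CompactSpace (UnitHoms u)] (hu : IsWeakUnit u)
    (harch : ∀ x y : E, (∀ n : ℕ, n • x ≤ y) → x ≤ 0) (x : E) :
    Dense {φ : UnitHoms u | ∃ t, HasValue u φ x t} := by
  have hu0 := hu.pos.le
  have huu := self_mem_orderIdeal hu0
  rw [dense_iff_inter_open]
  intro V hV ⟨φ, hφV⟩
  by_contra hempty
  rw [Set.not_nonempty_iff_eq_empty] at hempty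
  have hno : ∀ ψ ∈ V, ∀ t, ¬ HasValue u ψ x t := fun ψ hψ t ht =>
    Set.eq_empty_iff_forall_notMem.1 hempty ψ ⟨hψ, t, ht⟩
  obtain ⟨_, ⟨a, ha, rfl⟩, haφ, ha1, haV⟩ := (dense_range_eval hu0).exists_bump hV hφV
  set w := (a - (1 / 2 : ℝ) • u) ⊔ 0 with hw
  have hau : a - (1 / 2 : ℝ) • u ∈ orderIdeal u :=
    Submodule.sub_mem _ ha (Submodule.smul_mem _ _ huu)
  have hwu : w ∈ orderIdeal u := sup_mem_orderIdeal hau (Submodule.zero_mem _)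
  have hwval : ∀ ψ : UnitHoms u, ψ w = (ψ a - 1 / 2) ⊔ 0 := fun ψ => by
    rw [hw, ψ.2.map_sup _ hau _ (Submodule.zero_mem _), ψ.2.map_zero,
      ψ.2.map_sub ha (Submodule.smul_mem _ _ huu), ψ.2.map_smul _ _ huu, ψ.2.map_unit, mul_one]
  have hle : ∀ n : ℕ, 0 < n → n • w ≤ |x| := by
    intro n hn
    have hn' : (0 : ℝ) < n := Nat.cast_pos.2 hn
    set y := (n : ℝ)⁻¹ • x with hy
    have hyu := inf_mem_orderIdeal hu0 (abs_nonneg y)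
    have hwy : w ≤ |y| ⊓ u := by
      refine hu.le_of_forall_isUnitHom harch hwu hyu fun ψ hψ => ?_
      rw [show ψ w = (ψ a - 1 / 2) ⊔ 0 from hwval ⟨ψ, hψ⟩]
      refine sup_le ?_ (hψ.nonneg hyu (le_inf (abs_nonneg y) hu0))
      by_cases hψV : (⟨ψ, hψ⟩ : UnitHoms u) ∈ V
      · have h1 : ψ a ≤ 3 / 2 := ha1 ⟨ψ, hψ⟩
        -- Otherwise `y`, and hence its multiple `x`, would have a value at `ψ ∈ V`.
        have h2 : 1 ≤ ψ (|y| ⊓ u) := by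
          by_contra! hlt
          have hval := hψ.hasValue_smul hu0 (n : ℝ) (hψ.hasValue_of_lt hu0 hlt)
          rw [hy, smul_smul, mul_inv_cancel₀ hn'.ne', one_smul] at hval
          exact hno ⟨ψ, hψ⟩ hψV _ hval
        linarith
      · have h1 : ψ a ≤ 1 / 2 := haV ⟨ψ, hψ⟩ hψV
        linarith [hψ.nonneg hyu (le_inf (abs_nonneg y) hu0)]
    have h1 : n • w ≤ n • |y| := nsmul_le_nsmul_right (hwy.trans inf_le_left) n
    refine h1.trans ?_
    have hxy : x = (n : ℝ) • y := by rw [hy, smul_smul, mul_inv_cancel₀ hn'.ne', one_smul]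
    rw [← Nat.cast_smul_eq_nsmul ℝ, ← le_inv_smul_iff_of_pos hn']
    refine abs_le'.2 ⟨?_, ?_⟩
    · exact smul_le_smul_of_nonneg_left (le_abs_self x) (inv_nonneg.2 hn'.le)
    · rw [hy, ← smul_neg]
      exact smul_le_smul_of_nonneg_left (neg_le_abs x) (inv_nonneg.2 hn'.le)
  have hw0 : w ≤ 0 := harch w |x| fun n => by
    rcases Nat.eq_zero_or_pos n with rfl | hn
    · simp
    · exact hle n hn
  have h1 := φ.2.mono hwu (Submodule.zero_mem _) hw0
  rw [hwval, φ.2.map_zero] at h1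
  have h2 : (1 : ℝ) / 2 < φ a := haφ
  linarith [le_sup_left.trans h1]

section Represent

variable [CompactSpace (UnitHoms u)]

theorem eventually_hasValue (hu : IsWeakUnit u)
    (harch : ∀ x y : E, (∀ n : ℕ, n • x ≤ y) → x ≤ 0) (x : E) :
    ∀ᶠ φ : UnitHoms u in openDenseFilter (UnitHoms u), HasValue u φ x (value x φ) :=
  ⟨_, isOpen_setOf_hasValue hu.pos.le x, dense_setOf_hasValue hu harch x, fun φ ⟨t, ht⟩ => by
    change HasValue u φ x (value x φ)
    rwa [value_eq hu.pos.le ht]⟩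

theorem isDenselyContinuous_value (hu : IsWeakUnit u)
    (harch : ∀ x y : E, (∀ n : ℕ, n • x ≤ y) → x ≤ 0) (x : E) :
    IsDenselyContinuous (value (u := u) x) :=
  ⟨_, isOpen_setOf_hasValue hu.pos.le x, dense_setOf_hasValue hu harch x,
    continuousOn_value hu.pos.le x⟩

variable (hu : IsWeakUnit u) (harch : ∀ x y : E, (∀ n : ℕ, n • x ≤ y) → x ≤ 0)

/-- The representation of an Archimedean vector lattice with weak unit `u`. -/
def represent : E →ₗ[ℝ] SSpace (UnitHoms u) where
  toFun x := SSpace.mk (value x) (isDenselyContinuous_value hu harch x)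
  map_add' x y := by
    refine Subtype.ext (Germ.coe_eq.2 ?_)
    filter_upwards [eventually_hasValue hu harch x, eventually_hasValue hu harch y] with φ hx hy
    exact value_eq hu.pos.le (φ.2.hasValue_add hu.pos.le hx hy)
  map_smul' c x := by
    refine Subtype.ext (Germ.coe_eq.2 ?_)
    filter_upwards [eventually_hasValue hu harch x] with φ hx
    exact value_eq hu.pos.le (φ.2.hasValue_smul hu.pos.le c hx)

theorem represent_sup (x y : E) : represent hu harch (x ⊔ y) =
    represent hu harch x ⊔ represent hu harch y := by
  refine Subtype.ext (Germ.coe_eq.2 ?_)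
  filter_upwards [eventually_hasValue hu harch x, eventually_hasValue hu harch y] with φ hx hy
  exact value_eq hu.pos.le (φ.2.hasValue_sup hu.pos.le hx hy)

theorem isLatticeHom_represent : IsLatticeHom (represent hu harch) where
  map_sup := represent_sup hu harch
  map_inf x y := by
    have h : ∀ a b : E, a ⊓ b = a + b - a ⊔ b := fun a b => by
      rw [← inf_add_sup, add_sub_cancel_right]
    have h' : ∀ a b : SSpace (UnitHoms u), a ⊓ b = a + b - a ⊔ b := fun a b => by
      rw [← inf_add_sup, add_sub_cancel_right]
    rw [h, h', map_sub, map_add, represent_sup]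

theorem represent_of_mem {x : E} (hx : x ∈ orderIdeal u) :
    represent hu harch x = SSpace.ofContinuous (eval x) :=
  Subtype.ext (Germ.coe_eq.2 (Eventually.of_forall fun φ =>
    value_eq hu.pos.le (φ.2.hasValue_of_mem hu.pos.le hx)))

/-- If `x` maps to `0`, so does `|x| ⊓ u`. That element lies in the unit ideal, where homomorphisms
separate points, so it is zero and the weak unit forces `x = 0`. -/
theorem represent_injective : Function.Injective (represent hu harch) := by
  have hu0 := hu.pos.le
  rw [injective_iff_map_eq_zero]
  intro x hx
  have hxu := inf_mem_orderIdeal hu0 (abs_nonneg x)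
  refine hu.eq_zero_of_disjoint x (le_antisymm ?_ (le_inf (abs_nonneg x) hu0))
  have hT := isLatticeHom_represent hu harch
  have h0 : SSpace.ofContinuous (eval (u := u) (|x| ⊓ u)) = SSpace.ofContinuous 0 := by
    rw [← represent_of_mem hu harch hxu, hT.map_inf, hT.map_abs, hx, abs_zero,
      represent_of_mem hu harch (self_mem_orderIdeal hu0)]
    refine inf_of_le_left (SSpace.mk_le_mk (f := fun _ => 0)
      (hf := continuous_const.isDenselyContinuous).2 (Eventually.of_forall fun φ => ?_))
    exact φ.2.nonneg (self_mem_orderIdeal hu0) hu0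
  refine hu.le_of_forall_isUnitHom harch hxu (Submodule.zero_mem _) fun φ hφ => ?_
  rw [hφ.map_zero]
  exact (DFunLike.congr_fun (SSpace.ofContinuous_injective h0) (⟨φ, hφ⟩ : UnitHoms u)).le

theorem isUnitalRepresentation_represent : IsUnitalRepresentation u (represent hu harch) where
  isLatticeHom := isLatticeHom_represent hu harch
  injective := represent_injective hu harch
  map_unit := by
    rw [represent_of_mem hu harch (self_mem_orderIdeal hu.pos.le)]
    exact congrArg _ (ContinuousMap.ext fun φ => φ.2.map_unit)
  map_ideal x hx := ⟨_, represent_of_mem hu harch hx⟩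
  dense_image := (dense_range_eval hu.pos.le).mono (by
    rintro _ ⟨x, hx, rfl⟩
    exact ⟨x, hx, represent_of_mem hu harch hx⟩)

end Represent

end UnitHoms

end Representation

/-! ### Existence of a representation -/

section Existence

/-- Order completeness implies the Archimedean property: shifting the index by one shows that `s =
sup (n • x)` satisfies `s ≤ s - x`. -/
theorem nonpos_of_forall_nsmul_le {E : Type*} [ConditionallyCompleteLattice E] [AddCommGroup E]
    [IsOrderedAddMonoid E] (x y : E) (h : ∀ n : ℕ, n • x ≤ y) : x ≤ 0 := by
  have hlub : IsLUB (Set.range fun n : ℕ => n • x) (⨆ n : ℕ, n • x) :=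
    isLUB_ciSup ⟨y, by rintro _ ⟨n, rfl⟩; exact h n⟩
  set s := ⨆ n : ℕ, n • x
  have : s ≤ s - x := hlub.2 (by
    rintro _ ⟨n, rfl⟩
    rw [le_sub_iff_add_le]
    exact (succ_nsmul x n).symm.trans_le (hlub.1 ⟨n + 1, rfl⟩))
  simpa using this

section Lattice

variable {E : Type*} [Lattice E] [AddCommGroup E] [IsOrderedAddMonoid E]
  [Module ℝ E] [IsOrderedModule ℝ E]

/-- The disjoint complement of a set, as a band. -/
def disjointComplBand (S : Set E) : Band E where
  toSubmodule := disjointCompl S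
  isLatticeIdeal _ hx _ h := mem_disjointCompl_of_abs_le hx h
  mem_of_isLUB s hs a ha := by
    -- A least upper bound of the empty set is a least element; comparing it with `a - |a|` gives `a
    -- = 0`.
    rcases s.eq_empty_or_nonempty with rfl | ⟨b, hb⟩
    · have h := (isLUB_empty_iff.1 ha) (a - |a|)
      have h0 : |a| = 0 := le_antisymm (by simpa using h) (abs_nonneg a)
      exact mem_disjointCompl_of_abs_le (Submodule.zero_mem _) (by rw [h0, abs_zero])
    · have hneg : a⁻ ∈ disjointCompl S := by
        refine mem_disjointCompl_of_abs_le (hs b hb) ?_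
        rw [abs_of_nonneg (negPart_nonneg a)]
        exact (negPart_anti (ha.1 hb)).trans (sup_le (neg_le_abs b) (abs_nonneg b))
      have hpos : a⁺ ∈ disjointCompl S := by
        intro y hy
        rw [abs_of_nonneg (posPart_nonneg a)]
        set c := a⁺ ⊓ |y| with hc
        have hc0 : 0 ≤ c := le_inf (posPart_nonneg a) (abs_nonneg y)
        refine le_antisymm ?_ hc0
        -- For `z ∈ s` the elements `z⁺` and `c` are disjoint and both below `a⁺`, so their sum,
        -- which equals their supremum, is below `a⁺`; hence `a - c` still bounds `s`.
        have : a ≤ a - c := ha.2 fun z hz => by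
          have hzc : z⁺ ⊓ c = 0 := by
            refine le_antisymm ?_ (le_inf (posPart_nonneg z) hc0)
            rw [← hs z hz y hy]
            exact inf_le_inf (sup_le (le_abs_self z) (abs_nonneg z)) inf_le_right
          have h1 : z⁺ + c ≤ a⁺ := by
            rw [← inf_add_sup, hzc, zero_add]
            exact sup_le (posPart_mono (ha.1 hz)) inf_le_left
          calc z = z⁺ - z⁻ := (posPart_sub_negPart z).symm
            _ ≤ (a⁺ - c) - a⁻ :=
              sub_le_sub (le_sub_iff_add_le.2 h1) (negPart_anti (ha.1 hz))
            _ = a - c := by rw [sub_right_comm, posPart_sub_negPart]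
        simpa using this
      rw [← posPart_sub_negPart a]
      exact Submodule.sub_mem _ hpos hneg

instance Band.instIsOrderedModule (B : Band E) : IsOrderedModule ℝ B.toSubmodule where
  smul_le_smul_of_nonneg_left _ hc _ _ h := smul_le_smul_of_nonneg_left (β := E) h hc
  smul_le_smul_of_nonneg_right _ hx _ _ h := smul_le_smul_of_nonneg_right (β := E) h hx

/-- The band generated by an element. -/
def principalBand (u : E) : Band E := disjointComplBand {x | |x| ⊓ |u| = 0}

theorem self_mem_principalBand (u : E) : u ∈ (principalBand u).toSubmodule :=
  fun x hx => by rw [inf_comm]; exact hx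

/-- The principal band is the double disjoint complement of `u`, so an element of it disjoint from
`u` is disjoint from itself. -/
theorem isWeakUnit_principalBand {u : E} (hu : 0 < u) :
    IsWeakUnit (⟨u, self_mem_principalBand u⟩ : (principalBand u).toSubmodule) where
  pos := hu
  eq_zero_of_disjoint x hx := by
    have h : |(x : E)| ⊓ |u| = 0 := by
      rw [abs_of_pos hu]
      exact congrArg Subtype.val hx
    exact Subtype.ext (eq_zero_of_abs_inf_abs_self (x.2 _ h))

theorem disjoint_principalBand {u v : E} (h : |u| ⊓ |v| = 0) {x y : E}
    (hx : x ∈ (principalBand u).toSubmodule) (hy : y ∈ (principalBand v).toSubmodule) :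
    |x| ⊓ |y| = 0 :=
  hx y (hy u h)

/-- Zorn's lemma: a nonzero `x` disjoint from a maximal system would allow `|x|` to be adjoined. -/
theorem exists_maximal_disjoint (E : Type*) [Lattice E] [AddCommGroup E] [IsOrderedAddMonoid E] :
    ∃ S : Set E, (∀ u ∈ S, 0 < u) ∧ S.Pairwise (fun u v => |u| ⊓ |v| = 0) ∧
      ∀ x : E, (∀ u ∈ S, |x| ⊓ |u| = 0) → x = 0 := by
  obtain ⟨S, hS⟩ := zorn_subset
    {S : Set E | (∀ u ∈ S, 0 < u) ∧ S.Pairwise (fun u v => |u| ⊓ |v| = 0)} (fun c hc hchain => by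
      refine ⟨⋃₀ c, ⟨?_, ?_⟩, fun s hs => Set.subset_sUnion_of_mem hs⟩
      · rintro u ⟨s, hs, hu⟩
        exact (hc hs).1 u hu
      · exact (Set.pairwise_sUnion hchain.directedOn).2 fun s hs => (hc hs).2)
  refine ⟨S, hS.prop.1, hS.prop.2, fun x hx => ?_⟩
  by_contra hne
  have hpos : 0 < |x| := lt_of_le_of_ne (abs_nonneg x) fun h =>
    hne (eq_zero_of_abs_inf_abs_self (by rw [← h, inf_idem]))
  have hins : insert |x| S ⊆ S := hS.le_of_ge ⟨by
      rintro u (rfl | hu)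
      · exact hpos
      · exact hS.prop.1 u hu, by
      refine (Set.pairwise_insert).2 ⟨hS.prop.2, fun u hu _ => ?_⟩
      rw [abs_abs]
      exact ⟨hx u hu, by rw [inf_comm]; exact hx u hu⟩⟩ (Set.subset_insert _ _)
  have := hx |x| (hins (Set.mem_insert _ _))
  rw [abs_abs] at this
  exact hne (eq_zero_of_abs_inf_abs_self this)

end Lattice

theorem nonempty_bandRepresentation (E : Type u) [ConditionallyCompleteLattice E] [AddCommGroup E]
    [IsOrderedAddMonoid E] [Module ℝ E] [IsOrderedModule ℝ E] :
    Nonempty (BandRepresentation.{u, u, u} E) := by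
  obtain ⟨S, hpos, hdisj, hmax⟩ := exists_maximal_disjoint E
  have hunit := fun i : S => isWeakUnit_principalBand (hpos i i.2)
  -- The construction on a band needs only the Archimedean property, which is inherited from `E`.
  have harch : ∀ (i : S) (x y : (principalBand (i : E)).toSubmodule),
      (∀ n : ℕ, n • x ≤ y) → x ≤ 0 := fun i x y h =>
    nonpos_of_forall_nsmul_le (x : E) (y : E) h
  have : ∀ i : S, CompactSpace (UnitHoms
      (⟨i, self_mem_principalBand (i : E)⟩ : (principalBand (i : E)).toSubmodule)) := fun i =>
    isCompact_iff_compactSpace.1 (UnitHoms.isCompact_setOf_isUnitHom (hunit i).pos.le)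
  exact ⟨{
    ι := S
    B := fun i => principalBand (i : E)
    unit := fun i => ⟨i, self_mem_principalBand (i : E)⟩
    isWeakUnit := hunit
    disjoint := fun i j hij x hx y hy =>
      disjoint_principalBand (hdisj i.2 j.2 (Subtype.coe_injective.ne hij)) hx hy
    complete := fun x hx => hmax x fun u hu => hx ⟨u, hu⟩ u (self_mem_principalBand u)
    X := fun i => UnitHoms
      (⟨i, self_mem_principalBand (i : E)⟩ : (principalBand (i : E)).toSubmodule)
    T := fun i => UnitHoms.represent (hunit i) (harch i)
    isUnitalRepresentation := fun i =>
      UnitHoms.isUnitalRepresentation_represent (hunit i) (harch i) }⟩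

end Existence

end

theorem corollary3p5 {E : Type u} [ConditionallyCompleteLattice E] [AddCommGroup E]
    [IsOrderedAddMonoid E] [Module ℝ E] [IsOrderedModule ℝ E] :
    Nonempty (BandRepresentation.{u, u, u} E) ∧
    ∀ R : BandRepresentation.{u, v, w} E,
      ∃ T : E →ₗ[ℝ] SSpace (Σ i, R.X i),
        (∀ x, T x = R.map x) ∧ IsLatticeHom T ∧ Function.Injective T ∧
          IsLatticeIdeal (LinearMap.range T) :=
  ⟨nonempty_bandRepresentation E, fun R => ⟨R.mapₗ, fun _ => rfl, R.isLatticeHom_mapₗ,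
    R.mapₗ_injective, R.isLatticeIdeal_range_mapₗ⟩⟩
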